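/- **Setting.** Let $X$ be a (real or complex) Banach space. Consider $u'(t)+Au(t)=g(u(t))$ on $[0,T]$, with $u$ a mild solution, i.e. $u\in C([0,T],X)$ and $u(t)=e^{-tA}u(0)+\int_0^t e^{-(t-r)A}g(u(r))\,dr$. Consider an explicit $s$-stage Runge--Kutta method with real coefficients $a_{ij},b_i,c_i$, with $\sum_{j<i}a_{ij}=c_i$ for all $i$ (so $c_1=0$) and nodes $c_i\in[0,1]$. The corresponding Lawson method with step size $h$ maps $w$ to $$\Phi_h(w)=e^{-hA}w+h\sum_{i=1}^s b_i e^{-(1-c_i)hA}g(U_i),\qquad U_i=e^{-c_ihA}w+h\sum_{j<i}a_{ij}e^{-(c_i-c_j)hA}g(U_j).$$ The Runge--Kutta method has conventional order $p\ge 0$ if for every $y'=f(y)$ in some $\mathbb R^d$ with $f\in C^\infty$ its local error is $O(h^{p+1})$. For a rooted tree $\tau=[\tau_1,\dots,\tau_k]$ ($k\ge 0$; $k=0$ is the one-node tree) with $\rho(\tau)$ nodes define recursively, with one real variable per node, $$\Psi_\zeta(\tau)(\sigma,\cdot_1,\dots,\cdot_k,w)=e^{-(\zeta-\sigma)hA}\,g^{(k)}\bigl(e^{-\sigma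 hA}w\bigr)\bigl(\Psi_\sigma(\tau_1)(\cdot_1,w),\dots,\Psi_\sigma(\tau_k)(\cdot_k,w)\bigr),\qquad \Psi(\tau)=\Psi_1(\tau).$$ $C^{k,1}$ denotes the functions that are $k$ times continuously differentiable with Lipschitz continuous $k$th derivative. **Assumptions**, with constants $C_E,B,M$ and $r,H>0$: 1. $g$ is $p$ times differentiable in the $r$-neighbourhood of $\{u(t):0\le t\le T\}$, and its derivatives of orders $0,\dots,p$ are bounded there by $B$. 2. One of the following holds. * *(Group case.)* $-A$ generates a strongly continuous group with $\|e^{-tA}\|\le C_E$ for all $t\in\mathbb R$; and for every $\tau$ with $\rho(\tau)\le p$, every $t\in[0,T]$ and every $h\in(0,H]$, $\Psi(\tau)(\cdot,u(t))\in C^{p-\rho(\tau),1}([0,1]^{\rho(\tau)},X)$, the Lipschitz constant of the $(p-\rho(\tau))$th derivative being at most $M$. * *(Semigroup case.)* The nodes satisfy $0=c_1\le c_2\le\dots\le c_s\le 1$; $-A$ generates a strongly continuous semigroup with $\|e^{-tA}\|\le C_E$ for all $t\ge0$; and for every $\tau$ with $\rho(\tau)\le p$, every $t\in[0,T]$ and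 every $h\in(0,H]$, $\Psi(\tau)(\cdot,u(t))$ is $C^{p-\rho(\tau),1}$ on the domain of integration of the elementary integral (the points of $[0,1]^{\rho(\tau)}$ at which the variable of each node is at most the variable of its parent), the Lipschitz constant of the $(p-\rho(\tau))$th derivative being at most $M h^{p-\rho(\tau)+1}$. (In the time variables $h\sigma$ instead of $\sigma$ this bound is just $M$.) **Theorem.** Suppose that the Runge--Kutta method has conventional order $p$. Then the Lawson method has stiff order $p$: there are constants $C$ and $h_0>0$, depending only on the Runge--Kutta method, $p$, $C_E$, $B$, $r$, $H$ and $M$ (in particular not on $A$, nor on $X$, $g$, $u$, $T$), such that for all problems satisfying the assumptions $$\|u(t+h)-\Phi_h(u(t))\|\le C\,h^{p+1}\qquad\text{whenever } t\ge 0,\ 0<h\le h_0,\ t+h\le T.$$ For $t=0$ this is the bound $\|u(h)-u_1\|\le Ch^{p+1}$ of the local error. -/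

import Mathlib

noncomputable section

namespace Lawson

open Set Filter Topology MeasureTheory
open scoped ContDiff

/-! ### Explicit Runge-Kutta methods -/

/-- The coefficients of an `s`-stage explicit Runge-Kutta method. Only the entries `a i j` with
`j < i` are ever used. The simplifying assumption says `∑_{j < i} a i j = c i`; for the first
stage it reads `c = 0`. -/
structure RKMethod (s : ℕ) where
  a : Fin s → Fin s → ℝ
  b : Fin s → ℝ
  c : Fin s → ℝ
  row_sum : ∀ i, ∑ j ∈ Finset.Iio i, a i j = c i

section Methods

variable {s : ℕ} (m : RKMethod s) {X : Type*} [NormedAddCommGroup X] [NormedSpace ℝ X]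

/-- The stages `Y_i = y₀ + h ∑_{j < i} a_{ij} f(Y_j)` of the Runge-Kutta method for `y' = f(y)`. -/
def RKMethod.stage (f : X → X) (h : ℝ) (y₀ : X) (i : Fin s) : X :=
  y₀ + h • ∑ j : {j : Fin s // j < i}, m.a i j • f (RKMethod.stage f h y₀ j)
termination_by i
decreasing_by exact j.2

/-- One step `y₁ = y₀ + h ∑ b_i f(Y_i)` of the Runge-Kutta method for `y' = f(y)`. -/
def RKMethod.step (f : X → X) (h : ℝ) (y₀ : X) : X :=
  y₀ + h • ∑ i, m.b i • f (m.stage f h y₀ i)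

/-- Conventional (non-stiff) order (at least) `p`: for every ordinary differential equation
`y' = f(y)` in some `ℝ^d` with smooth right-hand side the local error is `O(h^(p+1))`. -/
def RKMethod.HasOrder (p : ℕ) : Prop :=
  ∀ (d : ℕ) (f : EuclideanSpace ℝ (Fin d) → EuclideanSpace ℝ (Fin d)), ContDiff ℝ ∞ f →
    ∀ (y : ℝ → EuclideanSpace ℝ (Fin d)) (δ : ℝ), 0 < δ →
      (∀ t ∈ Icc 0 δ, HasDerivWithinAt y (f (y t)) (Icc 0 δ) t) →
      ∃ C h₁ : ℝ, 0 < h₁ ∧ ∀ h ∈ Ioc 0 h₁, ‖y h - m.step f h (y 0)‖ ≤ C * h ^ (p + 1)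

/-- The stages `U_i = e^{-c_i h A} w + h ∑_{j < i} a_{ij} e^{-(c_i - c_j) h A} g(U_j)` of the Lawson
method; `S t` stands for `e^{-tA}`. -/
def RKMethod.lawsonStage (S : ℝ → X →L[ℝ] X) (g : X → X) (h : ℝ) (w : X) (i : Fin s) : X :=
  S (m.c i * h) w + h • ∑ j : {j : Fin s // j < i},
    m.a i j • S ((m.c i - m.c j) * h) (g (RKMethod.lawsonStage S g h w j))
termination_by i
decreasing_by exact j.2

/-- One step `u₁ = e^{-hA} w + h ∑ b_i e^{-(1 - c_i) h A} g(U_i)` of the Lawson method, started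
from `w`. -/
def RKMethod.lawsonStep (S : ℝ → X →L[ℝ] X) (g : X → X) (h : ℝ) (w : X) : X :=
  S h w + h • ∑ i, m.b i • S ((1 - m.c i) * h) (g (m.lawsonStage S g h w i))

end Methods

/-! ### Semigroups, groups, generators, mild solutions -/

section Evolution

variable {X : Type*} [NormedAddCommGroup X] [NormedSpace ℝ X]

/-- `(S t)_{t ≥ 0}` is a strongly continuous semigroup (values at `t < 0` are irrelevant). -/
structure IsC0Semigroup (S : ℝ → X →L[ℝ] X) : Prop where
  zero : S 0 = ContinuousLinearMap.id ℝ X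
  add : ∀ t₁ t₂, 0 ≤ t₁ → 0 ≤ t₂ → S (t₁ + t₂) = (S t₁).comp (S t₂)
  continuousOn : ∀ x, ContinuousOn (fun t => S t x) (Ici 0)

/-- `(S t)_{t ∈ ℝ}` is a strongly continuous group. -/
structure IsC0Group (S : ℝ → X →L[ℝ] X) : Prop where
  zero : S 0 = ContinuousLinearMap.id ℝ X
  add : ∀ t₁ t₂, S (t₁ + t₂) = (S t₁).comp (S t₂)
  continuous : ∀ x, Continuous fun t => S t x

/-- The (unbounded) operator `G` is the infinitesimal generator of `S`: `x` is in the domain of `G`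
with `G x = y` exactly when `(S t x - x) / t → y` as `t ↓ 0`. -/
def IsGenerator (G : X →ₗ.[ℝ] X) (S : ℝ → X →L[ℝ] X) : Prop :=
  ∀ x y : X, (x, y) ∈ G.graph ↔
    Tendsto (fun t : ℝ => t⁻¹ • (S t x - x)) (𝓝[>] 0) (𝓝 y)

/-- `u` is a (mild) solution on `[0, T]` of `u' + A u = g(u)`, where `S t = e^{-tA}`: it is
continuous and satisfies the variation-of-constants formula. -/
structure IsMildSolution (S : ℝ → X →L[ℝ] X) (g : X → X) (T : ℝ) (u : ℝ → X) : Prop where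
  continuousOn : ContinuousOn u (Icc 0 T)
  integrable : ∀ t ∈ Icc 0 T, IntervalIntegrable (fun r => S (t - r) (g (u r))) volume 0 t
  duhamel : ∀ t ∈ Icc 0 T, u t = S t (u 0) + ∫ r in (0 : ℝ)..t, S (t - r) (g (u r))

/-- `g` is `p` times (Fréchet) differentiable on the open set `U`, and its derivatives of the
orders `0, …, p` are bounded there by `B`. -/
def BoundedDerivs (p : ℕ) (g : X → X) (U : Set X) (B : ℝ) : Prop :=
  (∀ k < p, DifferentiableOn ℝ (iteratedFDeriv ℝ k g) U) ∧
    ∀ k ≤ p, ∀ x ∈ U, ‖iteratedFDeriv ℝ k g x‖ ≤ B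

/-- `f` is `k` times continuously differentiable on `D`, and its `k`-th derivative is Lipschitz
continuous on `D` with constant `L`, i.e. `f ∈ C^{k,1}(D)` with `C^{k,1}`-seminorm at most `L`. -/
def IsCkLip {V : Type*} [NormedAddCommGroup V] [NormedSpace ℝ V] (k : ℕ) (L : ℝ) (f : V → X)
    (D : Set V) : Prop :=
  ContDiffOn ℝ k f D ∧ ∀ x ∈ D, ∀ y ∈ D,
    ‖iteratedFDerivWithin ℝ k f D x - iteratedFDerivWithin ℝ k f D y‖ ≤ L * ‖x - y‖

end Evolution

/-! ### Rooted trees and the integrands of the elementary integrals -/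

/-- Rooted trees; `node k τ` is `[τ_1, …, τ_k]`, and `node 0 _` is the one-node tree. The subtrees
are listed in an order, so an unordered tree may have several representatives; by the symmetry of
the derivatives of `g` their integrands differ only by a permutation of the variables. -/
inductive RTree : Type
  | node (k : ℕ) (τ : Fin k → RTree) : RTree

namespace RTree

/-- The number `ρ(τ)` of nodes. -/
def order : RTree → ℕ
  | node _ τ => 1 + ∑ i, (τ i).order

/-- The nodes of a tree: the root `none`, and the nodes of the subtrees. -/
def Node : RTree → Type
  | node k τ => Option (Σ i : Fin k, (τ i).Node)

instance instFintypeNode : (τ : RTree) → Fintype τ.Node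
  | node k τ =>
    letI : ∀ i, Fintype (τ i).Node := fun i => instFintypeNode (τ i)
    inferInstanceAs (Fintype (Option (Σ i : Fin k, (τ i).Node)))

theorem card_node : ∀ τ : RTree, Fintype.card τ.Node = τ.order
  | node k τ => by
    let : ∀ i, Fintype (τ i).Node := fun i => instFintypeNode (τ i)
    change Fintype.card (Option (Σ i : Fin k, (τ i).Node)) = _
    rw [Fintype.card_option, Fintype.card_sigma, order, add_comm]
    exact congrArg (1 + ·) (Finset.sum_congr rfl fun i _ => card_node (τ i))

/-- The value of the variables `σ` at the root. -/
def rootVar {k : ℕ} {τ : Fin k → RTree} (σ : (node k τ).Node → ℝ) : ℝ :=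
  σ (none : Option (Σ i : Fin k, (τ i).Node))

/-- The variables belonging to the `i`-th subtree. -/
def subVars {k : ℕ} {τ : Fin k → RTree} (σ : (node k τ).Node → ℝ) (i : Fin k) :
    (τ i).Node → ℝ :=
  fun v => σ (some ⟨i, v⟩ : Option (Σ i : Fin k, (τ i).Node))

/-- The integrand `Ψ_ζ(τ)(·, w)` for the step size `h`, with `S t = e^{-tA}`:
`Ψ_ζ([τ_1, …, τ_k])(σ, ·_1, …, ·_k, w)
  = e^{-(ζ-σ)hA} g^{(k)}(e^{-σhA} w) (Ψ_σ(τ_1)(·_1, w), …, Ψ_σ(τ_k)(·_k, w))`,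
a function of `ρ(τ)` real variables, one for each node. -/
def integrand {X : Type*} [NormedAddCommGroup X] [NormedSpace ℝ X]
    (S : ℝ → X →L[ℝ] X) (g : X → X) (h : ℝ) (w : X) :
    (τ : RTree) → (ζ : ℝ) → (τ.Node → ℝ) → X
  | node k τ => fun ζ σ =>
    S ((ζ - rootVar σ) * h) (iteratedFDeriv ℝ k g (S (rootVar σ * h) w)
      fun i => integrand S g h w (τ i) (rootVar σ) (subVars σ i))

/-- The unit cube `[0,1]^{ρ(τ)}`. -/
def cube (τ : RTree) : Set (τ.Node → ℝ) := Icc 0 1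

/-- The domain of integration of the elementary integral `G_ζ(τ)`: the root variable is in
`[0, ζ]`, every other variable is between `0` and the variable of its parent node. -/
def simplex : (τ : RTree) → (ζ : ℝ) → Set (τ.Node → ℝ)
  | node _ τ => fun ζ => {σ | rootVar σ ∈ Icc 0 ζ ∧ ∀ i, subVars σ i ∈ simplex (τ i) (rootVar σ)}

end RTree

end Lawson

end

/-! The exact solution is not expanded into elementary integrals. It is reached as the limit, as `N
→ ∞`, of the Lawson scheme built on `N` Euler steps of length `h / N`. That scheme is itself a
Lawson method (`eulerMethod N`), so method and solution are treated by one and the same expansion.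

Expanding `g` around the linear flow and substituting repeatedly, a Lawson step is `e^{-hA} w` plus
a finite sum over trees of `h^ρ(τ)` times a quadrature of `Ψ(τ)`, up to `O(h^(p+1))`
(`StepBounds.norm_lawsonStep_sub_truncSum_le`). The constant depends on sums of absolute
coefficients, not on the number of stages, so it is uniform in `N`. Trees with more than `p` nodes
are negligible by size. For the others the regularity assumption puts `Ψ(τ)` within
`O(h^(p-ρ(τ)+1))` of a polynomial of degree `p - ρ(τ)`, whose quadrature is a combination of scalar
moments.

Conventional order `p` fixes these moments: applied to the polynomial system `y_v' = t^(n_v) ∏ y_w`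
(`w` the children of `v`), the method must reproduce the integral of each monomial over the simplex
as long as number of nodes plus degree is at most `p` (`RKMethod.HasOrder.moment_eq`). The Euler
moments converge to the same integrals (`tendsto_moment_eulerMethod`). Hence the two Lawson steps
differ by at most `C h^(p+1)` plus a term vanishing as `N → ∞`, and `IsMildSolution.tendsto_euler`
identifies the limit.

In the semigroup case ordered nodes keep every quadrature point in the simplex, where the assumed
bound already carries the power of `h`. In the group case the power comes from rescaling: `Ψ(τ)` for
step `h` is, up to a group operator, `Ψ(τ)` for step `H` on the cube shrunk by `h / H`. -/

noncomputable section

namespace Lawson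

open Set Filter Topology MeasureTheory
open scoped ContDiff

/-! ### Weights and moments of a tableau along a tree -/

namespace RTree

/-- The values of `σ` on the nodes of the `l`-th subtree. -/
def branch {α : Type*} {k : ℕ} {τ : Fin k → RTree} (σ : (node k τ).Node → α) (l : Fin k) :
    (τ l).Node → α :=
  fun v => σ (some ⟨l, v⟩ : Option (Σ i : Fin k, (τ i).Node))

/-- The value of `σ` at the root. -/
def atRoot {α : Type*} {k : ℕ} {τ : Fin k → RTree} (σ : (node k τ).Node → α) : α :=
  σ (none : Option (Σ i : Fin k, (τ i).Node))

/-- A labelling of the nodes is a label of the root together with labellings of the branches. -/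
def labelEquiv {α : Type*} {k : ℕ} (τ : Fin k → RTree) :
    ((node k τ).Node → α) ≃ α × (∀ l, (τ l).Node → α) where
  toFun σ := (atRoot σ, branch σ)
  invFun x := fun v : Option (Σ i : Fin k, (τ i).Node) => match v with
    | none => x.1
    | some ⟨l, v⟩ => x.2 l v
  left_inv σ := by
    funext v
    rcases v with _ | ⟨l, v⟩ <;> rfl
  right_inv _ := rfl

theorem prod_node {M : Type*} [CommMonoid M] {k : ℕ} {τ : Fin k → RTree}
    (F : (node k τ).Node → M) : ∏ v, F v = atRoot F * ∏ l, ∏ v, branch F l v := by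
  let : ∀ i, Fintype (τ i).Node := fun i => instFintypeNode (τ i)
  exact (Fintype.prod_option (α := Σ i : Fin k, (τ i).Node) F).trans
    (congrArg (atRoot F * ·) (Fintype.prod_sigma _))

theorem sum_node {M : Type*} [AddCommMonoid M] {k : ℕ} {τ : Fin k → RTree}
    (F : (node k τ).Node → M) : ∑ v, F v = atRoot F + ∑ l, ∑ v, branch F l v := by
  let : ∀ i, Fintype (τ i).Node := fun i => instFintypeNode (τ i)
  exact (Fintype.sum_option (α := Σ i : Fin k, (τ i).Node) F).trans
    (congrArg (atRoot F + ·) (Fintype.sum_sigma _))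

instance : (τ : RTree) → DecidableEq τ.Node := fun _ => Classical.decEq _

theorem sum_label {ι M : Type*} [Fintype ι] [AddCommMonoid M] {k : ℕ} {τ : Fin k → RTree}
    (F : ι → (∀ l, (τ l).Node → ι) → M) :
    ∑ φ : (node k τ).Node → ι, F (atRoot φ) (branch φ) =
      ∑ j, ∑ ψ : ∀ l, (τ l).Node → ι, F j ψ := by
  rw [← Fintype.sum_prod_type']
  exact Fintype.sum_equiv (labelEquiv τ) _ _ fun _ => rfl

variable {ι : Type*}

/-- The product of the coefficients along the edges of a tree whose nodes are labelled by stages;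
the root edge carries the weight `β`. -/
def treeWeight (a : ι → ι → ℝ) : (τ : RTree) → (ι → ℝ) → (τ.Node → ι) → ℝ
  | node _ τ, β, φ =>
    β (atRoot φ) * ∏ l, treeWeight a (τ l) (a (atRoot φ)) (branch φ l)

/-- The value of the tree quadrature on the monomial `∏ v, σ v ^ n v`. -/
def moment [Fintype ι] (a : ι → ι → ℝ) (c : ι → ℝ) : (τ : RTree) → (τ.Node → ℕ) → (ι → ℝ) → ℝ
  | node _ τ, n, β =>
    ∑ j, β j * (c j ^ atRoot n * ∏ l, moment a c (τ l) (branch n l) (a j))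

/-- The degree of homogeneity of the integral of `∏ v, σ v ^ n v` over the simplex. -/
def weight : (τ : RTree) → (τ.Node → ℕ) → ℕ
  | node _ τ, n => 1 + atRoot n + ∑ l, weight (τ l) (branch n l)

/-- The integral of the monomial `∏ v, σ v ^ n v` over the simplex. -/
def simplexMoment : (τ : RTree) → (τ.Node → ℕ) → ℝ
  | node k τ, n =>
    (∏ l, simplexMoment (τ l) (branch n l)) / (weight (node k τ) n : ℝ)

/-- Hence the order conditions with weight at most `p` cover exactly the monomials of degree at most
`p - ρ(τ)`, the degree of the Taylor polynomials used later. -/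
theorem weight_eq : ∀ (τ : RTree) (n : τ.Node → ℕ), weight τ n = τ.order + ∑ v, n v
  | node k τ, n => by
    rw [weight, order, sum_node, Finset.sum_congr rfl fun l _ => weight_eq (τ l) (branch n l),
      Finset.sum_add_distrib]
    omega

theorem order_pos : ∀ τ : RTree, 0 < τ.order
  | node _ _ => by rw [order]; omega

theorem weight_pos (τ : RTree) (n : τ.Node → ℕ) : 0 < weight τ n := by
  rw [weight_eq]
  exact Nat.add_pos_left τ.order_pos _

/-- Once the root label is fixed the summand factors over the branches, so the sum over labellings
becomes a product of sums. -/
theorem sum_treeWeight_mul_prod [Fintype ι] (a : ι → ι → ℝ) (c : ι → ℝ) :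
    ∀ (τ : RTree) (n : τ.Node → ℕ) (β : ι → ℝ),
      ∑ φ : τ.Node → ι, treeWeight a τ β φ * ∏ v, c (φ v) ^ n v = moment a c τ n β
  | node k τ, n, β => by
    rw [moment]
    have h1 : ∀ φ : (node k τ).Node → ι,
        treeWeight a (node k τ) β φ * ∏ v, c (φ v) ^ n v =
          β (atRoot φ) * (c (atRoot φ) ^ atRoot n *
            ∏ l, (treeWeight a (τ l) (a (atRoot φ)) (branch φ l) *
              ∏ v, c (branch φ l v) ^ branch n l v)) := by
      intro φ
      rw [treeWeight, prod_node]
      simp only [Finset.prod_mul_distrib]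
      simp only [atRoot, branch]
      ring
    rw [Finset.sum_congr rfl fun φ _ => h1 φ, sum_label fun j ψ => β j * (c j ^ atRoot n *
      ∏ l, (treeWeight a (τ l) (a j) (ψ l) * ∏ v, c (ψ l v) ^ branch n l v))]
    refine Finset.sum_congr rfl fun j _ => ?_
    rw [← Finset.mul_sum, ← Finset.mul_sum]
    congr 2
    have := Finset.prod_univ_sum (fun l => (Finset.univ : Finset ((τ l).Node → ι)))
      (fun l ψ => treeWeight a (τ l) (a j) ψ * ∏ v, c (ψ v) ^ branch n l v)
    rw [Fintype.piFinset_univ] at this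
    rw [← this]
    exact Finset.prod_congr rfl fun l _ => sum_treeWeight_mul_prod a c (τ l) (branch n l) (a j)

theorem abs_treeWeight (a : ι → ι → ℝ) : ∀ (τ : RTree) (β : ι → ℝ) (φ : τ.Node → ι),
    |treeWeight a τ β φ| = treeWeight (fun i j => |a i j|) τ (fun j => |β j|) φ
  | node k τ, β, φ => by
    rw [treeWeight, treeWeight, abs_mul, Finset.abs_prod]
    congr 1
    exact Finset.prod_congr rfl fun l _ => abs_treeWeight a (τ l) _ _

/-- Moments of nonnegative tableaux with nodes in the unit interval. -/
theorem moment_nonneg_le [Fintype ι] {a : ι → ι → ℝ} {c : ι → ℝ} {K : ℝ} (hK : 1 ≤ K)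
    (ha0 : ∀ i j, 0 ≤ a i j) (ha : ∀ i, ∑ j, a i j ≤ K) (hc : ∀ i, c i ∈ Icc (0 : ℝ) 1) :
    ∀ (τ : RTree) (n : τ.Node → ℕ) (β : ι → ℝ), (∀ j, 0 ≤ β j) → ∑ j, β j ≤ K →
      0 ≤ moment a c τ n β ∧ moment a c τ n β ≤ K ^ τ.order
  | node k τ, n, β, hβ0, hβ => by
    have ih := fun l j => moment_nonneg_le hK ha0 ha hc (τ l) (branch n l) (a j) (ha0 j) (ha j)
    rw [moment, order]
    constructor
    · exact Finset.sum_nonneg fun j _ => mul_nonneg (hβ0 j)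
        (mul_nonneg (pow_nonneg (hc j).1 _) (Finset.prod_nonneg fun l _ => (ih l j).1))
    · have hP : ∀ j, c j ^ atRoot n * ∏ l, moment a c (τ l) (branch n l) (a j) ≤
          K ^ ∑ l, (τ l).order := by
        intro j
        rw [← Finset.prod_pow_eq_pow_sum, ← one_mul (∏ l, K ^ (τ l).order)]
        exact mul_le_mul (pow_le_one₀ (hc j).1 (hc j).2)
          (Finset.prod_le_prod (fun l _ => (ih l j).1) fun l _ => (ih l j).2)
          (Finset.prod_nonneg fun l _ => (ih l j).1) zero_le_one
      calc _ ≤ ∑ j, β j * K ^ ∑ l, (τ l).order :=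
            Finset.sum_le_sum fun j _ => mul_le_mul_of_nonneg_left (hP j) (hβ0 j)
        _ = (∑ j, β j) * K ^ ∑ l, (τ l).order := by rw [Finset.sum_mul]
        _ ≤ K * K ^ ∑ l, (τ l).order :=
            mul_le_mul_of_nonneg_right hβ (pow_nonneg (zero_le_one.trans hK) _)
        _ = _ := by rw [pow_add, pow_one]

/-- The total absolute weight is the moment of the constant monomial for the tableau of absolute
values; the nodes then play no role and are set to zero. -/
theorem sum_abs_treeWeight_le [Fintype ι] {a : ι → ι → ℝ} {K : ℝ} (hK : 1 ≤ K)
    (ha : ∀ i, ∑ j, |a i j| ≤ K) (τ : RTree) {β : ι → ℝ} (hβ : ∑ j, |β j| ≤ K) :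
    ∑ φ : τ.Node → ι, |treeWeight a τ β φ| ≤ K ^ τ.order := by
  have h1 := sum_treeWeight_mul_prod (fun i j => |a i j|) (fun _ => 0) τ (fun _ => 0)
    (fun j => |β j|)
  simp only [pow_zero, Finset.prod_const_one, mul_one] at h1
  simp only [abs_treeWeight, h1]
  exact (moment_nonneg_le hK (fun i j => abs_nonneg _) ha (fun _ => by simp) τ _ _
    (fun j => abs_nonneg _) hβ).2

theorem simplexMoment_mem : ∀ (τ : RTree) (n : τ.Node → ℕ), simplexMoment τ n ∈ Icc (0 : ℝ) 1
  | node k τ, n => by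
    have ih := fun l => simplexMoment_mem (τ l) (branch n l)
    have h1 : (1 : ℝ) ≤ weight (node k τ) n := by exact_mod_cast weight_pos _ n
    rw [simplexMoment]
    refine ⟨div_nonneg (Finset.prod_nonneg fun l _ => (ih l).1) (by positivity), ?_⟩
    refine (div_le_one (by positivity)).2 (le_trans ?_ h1)
    exact Finset.prod_le_one (fun l _ => (ih l).1) fun l _ => (ih l).2

end RTree

/-! ### The order conditions -/

section Conjugation

variable {s : ℕ} (m : RKMethod s)

/-- The strictly lower triangular coefficient matrix. -/
def RKMethod.tab (i j : Fin s) : ℝ := if j < i then m.a i j else 0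

theorem RKMethod.tab_eq_zero {i j : Fin s} (h : ¬ j < i) : m.tab i j = 0 := if_neg h

theorem RKMethod.sum_subtype_lt {X : Type*} [AddCommGroup X] [Module ℝ X] (i : Fin s)
    (F : Fin s → X) : ∑ j : {j : Fin s // j < i}, m.a i j • F j = ∑ j, m.tab i j • F j := by
  rw [← Finset.sum_subtype (Finset.univ.filter (· < i)) (by simp) fun j => m.a i j • F j,
    Finset.sum_filter]
  refine Finset.sum_congr rfl fun j _ => ?_
  unfold RKMethod.tab
  split_ifs <;> simp

theorem RKMethod.sum_tab (i : Fin s) : ∑ j, m.tab i j = m.c i := by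
  rw [← m.row_sum i, ← Finset.filter_gt_eq_Iio, Finset.sum_filter]
  rfl

variable {X Y : Type*} [NormedAddCommGroup X] [NormedSpace ℝ X] [NormedAddCommGroup Y]
  [NormedSpace ℝ Y]

theorem RKMethod.stage_eq (f : X → X) (h : ℝ) (y₀ : X) (i : Fin s) :
    m.stage f h y₀ i = y₀ + h • ∑ j, m.tab i j • f (m.stage f h y₀ j) := by
  rw [RKMethod.stage, m.sum_subtype_lt i fun j => f (m.stage f h y₀ j)]

theorem RKMethod.lawsonStage_eq (S : ℝ → X →L[ℝ] X) (g : X → X) (h : ℝ) (w : X) (i : Fin s) :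
    m.lawsonStage S g h w i = S (m.c i * h) w +
      h • ∑ j, m.tab i j • S ((m.c i - m.c j) * h) (g (m.lawsonStage S g h w j)) := by
  rw [RKMethod.lawsonStage,
    m.sum_subtype_lt i fun j => S ((m.c i - m.c j) * h) (g (m.lawsonStage S g h w j))]

theorem RKMethod.stage_conj (L : X ≃L[ℝ] Y) (f : X → X) (h : ℝ) (y₀ : X) (i : Fin s) :
    m.stage (fun y => L (f (L.symm y))) h (L y₀) i = L (m.stage f h y₀ i) := by
  induction i using WellFoundedLT.induction with
  | ind i ih =>
    rw [stage_eq, stage_eq, map_add, map_smul, map_sum]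
    congr 2
    refine Finset.sum_congr rfl fun j _ => ?_
    by_cases hj : j < i
    · rw [ih j hj, map_smul, L.symm_apply_apply]
    · simp [m.tab_eq_zero hj]

theorem RKMethod.step_conj (L : X ≃L[ℝ] Y) (f : X → X) (h : ℝ) (y₀ : X) :
    m.step (fun y => L (f (L.symm y))) h (L y₀) = L (m.step f h y₀) := by
  simp only [RKMethod.step, stage_conj, L.symm_apply_apply, map_add, map_smul, map_sum]

/-- Runge-Kutta methods commute with linear changes of coordinates, so the order property passes
from Euclidean spaces to the product space of the test systems. -/
theorem RKMethod.HasOrder.finiteDimensional {m : RKMethod s} {p : ℕ} (hp : m.HasOrder p)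
    [FiniteDimensional ℝ X] {f : X → X} (hf : ContDiff ℝ ∞ f) {y : ℝ → X} {δ : ℝ} (hδ : 0 < δ)
    (hy : ∀ t ∈ Icc 0 δ, HasDerivWithinAt y (f (y t)) (Icc 0 δ) t) :
    ∃ C h₁ : ℝ, 0 < h₁ ∧ ∀ h ∈ Ioc 0 h₁, ‖y h - m.step f h (y 0)‖ ≤ C * h ^ (p + 1) := by
  let L : X ≃L[ℝ] EuclideanSpace ℝ (Fin (Module.finrank ℝ X)) :=
    ContinuousLinearEquiv.ofFinrankEq (by simp)
  obtain ⟨C, h₁, hh, hC⟩ := hp _ (fun z => L (f (L.symm z)))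
    (L.contDiff.comp (hf.comp L.symm.contDiff)) (fun t => L (y t)) δ hδ fun t ht => by
      rw [L.symm_apply_apply]
      exact L.toContinuousLinearMap.hasFDerivAt.comp_hasDerivWithinAt t (hy t ht)
  refine ⟨‖(L.symm : EuclideanSpace ℝ (Fin (Module.finrank ℝ X)) →L[ℝ] X)‖ * C, h₁, hh,
    fun h hh' => ?_⟩
  have h1 := hC h hh'
  rw [m.step_conj, ← map_sub] at h1
  calc ‖y h - m.step f h (y 0)‖
      = ‖(L.symm : EuclideanSpace ℝ (Fin (Module.finrank ℝ X)) →L[ℝ] X)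
          (L (y h - m.step f h (y 0)))‖ := by simp
    _ ≤ _ := ContinuousLinearMap.le_opNorm _ _
    _ ≤ _ := by rw [mul_assoc]; gcongr

end Conjugation

/-! ### Test systems attached to trees with monomial decorations -/

namespace RTree

/-- The value at the root. -/
def rootVal {α : Type*} : (τ : RTree) → (τ.Node → α) → α
  | node _ _, y => atRoot y

/-- For each node the product of the values at its children. -/
def childProd : (τ : RTree) → (τ.Node → ℝ) → τ.Node → ℝ
  | node _ τ, y => (labelEquiv τ).symm
    (∏ l, rootVal (τ l) (branch y l), fun l => childProd (τ l) (branch y l))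

/-- The solution, started from zero, of the test system `y_v' = t ^ n v * ∏ y_w`, the product being
over the children `w` of `v`. -/
def testSolution : (τ : RTree) → (τ.Node → ℕ) → ℝ → τ.Node → ℝ
  | node k τ, n, t => (labelEquiv τ).symm
    (simplexMoment (node k τ) n * t ^ weight (node k τ) n,
      fun l => testSolution (τ l) (branch n l) t)

/-- The stage with coefficients `β` of a Runge-Kutta method applied to the test system. -/
def testStage {ι : Type*} [Fintype ι] (a : ι → ι → ℝ) (c : ι → ℝ) (h : ℝ) (β : ι → ℝ) :
    (τ : RTree) → (τ.Node → ℕ) → τ.Node → ℝ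
  | node k τ, n => (labelEquiv τ).symm
    (h ^ weight (node k τ) n * moment a c (node k τ) n β,
      fun l => testStage a c h β (τ l) (branch n l))

theorem rootVal_testSolution (τ : RTree) (n : τ.Node → ℕ) (t : ℝ) :
    rootVal τ (testSolution τ n t) = simplexMoment τ n * t ^ weight τ n := by
  cases τ
  rfl

theorem rootVal_testStage {ι : Type*} [Fintype ι] (a : ι → ι → ℝ) (c : ι → ℝ) (h : ℝ)
    (β : ι → ℝ) (τ : RTree) (n : τ.Node → ℕ) :
    rootVal τ (testStage a c h β τ n) = h ^ weight τ n * moment a c τ n β := by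
  cases τ
  rfl

/-- The children contribute a power of `t` whose exponent is the sum of their weights; integrating
it together with `t ^ n v` divides by the weight, as in the recursion for `simplexMoment`. -/
theorem hasDerivAt_testSolution : ∀ (τ : RTree) (n : τ.Node → ℕ) (v : τ.Node) (t : ℝ),
    HasDerivAt (fun t => testSolution τ n t v) (t ^ n v * childProd τ (testSolution τ n t) v) t
  | node k τ, n, none, t => by
    change HasDerivAt (fun t => simplexMoment (node k τ) n * t ^ weight (node k τ) n)
      (t ^ atRoot n * ∏ l, rootVal (τ l) (testSolution (τ l) (branch n l) t)) t
    refine ((hasDerivAt_pow (weight (node k τ) n) t).const_mul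
      (simplexMoment (node k τ) n)).congr_deriv ?_
    have hw : (weight (node k τ) n : ℝ) ≠ 0 := by exact_mod_cast (weight_pos _ n).ne'
    have hw' : weight (node k τ) n - 1 = atRoot n + ∑ l, weight (τ l) (branch n l) := by
      rw [weight]; omega
    rw [hw', simplexMoment, pow_add, ← Finset.prod_pow_eq_pow_sum]
    simp only [rootVal_testSolution, Finset.prod_mul_distrib]
    field_simp
  | node k τ, n, some ⟨l, v⟩, t => hasDerivAt_testSolution (τ l) (branch n l) v t

theorem testSolution_zero : ∀ (τ : RTree) (n : τ.Node → ℕ) (v : τ.Node), testSolution τ n 0 v = 0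
  | node k τ, n, none => by
    change simplexMoment (node k τ) n * 0 ^ weight (node k τ) n = 0
    rw [zero_pow (weight_pos _ n).ne', mul_zero]
  | node k τ, n, some ⟨l, v⟩ => testSolution_zero (τ l) (branch n l) v

/-- The discrete counterpart of the test equation: by homogeneity all powers of `h` collect into `h
^ weight`, leaving the recursion for `moment`. -/
theorem testStage_eq {ι : Type*} [Fintype ι] (a : ι → ι → ℝ) (c : ι → ℝ) (h : ℝ) (β : ι → ℝ) :
    ∀ (τ : RTree) (n : τ.Node → ℕ) (v : τ.Node), testStage a c h β τ n v =
      h * ∑ j, β j * ((c j * h) ^ n v * childProd τ (testStage a c h (a j) τ n) v)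
  | node k τ, n, none => by
    change h ^ weight (node k τ) n * moment a c (node k τ) n β = h * ∑ j, β j *
      ((c j * h) ^ atRoot n * ∏ l, rootVal (τ l) (testStage a c h (a j) (τ l) (branch n l)))
    simp only [rootVal_testStage, Finset.prod_mul_distrib, Finset.prod_pow_eq_pow_sum]
    rw [moment, weight, Finset.mul_sum, Finset.mul_sum]
    refine Finset.sum_congr rfl fun j _ => ?_
    rw [pow_add, pow_add]
    ring
  | node k τ, n, some ⟨l, v⟩ => testStage_eq a c h β (τ l) (branch n l) v

theorem contDiff_rootVal (τ : RTree) : ContDiff ℝ ∞ (fun y : τ.Node → ℝ => rootVal τ y) := by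
  cases τ
  exact contDiff_apply ℝ ℝ _

theorem contDiff_branch {k : ℕ} {τ : Fin k → RTree} (l : Fin k) :
    ContDiff ℝ ∞ fun y : (node k τ).Node → ℝ => branch y l :=
  contDiff_pi.2 fun _ => contDiff_apply ℝ ℝ _

theorem contDiff_childProd : ∀ (τ : RTree) (v : τ.Node),
    ContDiff ℝ ∞ (fun y : τ.Node → ℝ => childProd τ y v)
  | node k τ, none => by
    change ContDiff ℝ ∞ fun y : (node k τ).Node → ℝ => ∏ l, rootVal (τ l) (branch y l)
    exact contDiff_prod fun l _ => (contDiff_rootVal (τ l)).comp (contDiff_branch l)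
  | node k τ, some ⟨l, v⟩ => (contDiff_childProd (τ l) v).comp (contDiff_branch l)

/-- The autonomous form of the test system. -/
def testField (τ : RTree) (n : τ.Node → ℕ) (x : ℝ × (τ.Node → ℝ)) : ℝ × (τ.Node → ℝ) :=
  (1, fun v => x.1 ^ n v * childProd τ x.2 v)

theorem contDiff_testField (τ : RTree) (n : τ.Node → ℕ) : ContDiff ℝ ∞ (testField τ n) :=
  contDiff_const.prodMk <| contDiff_pi.2 fun v =>
    (contDiff_fst.pow _).mul ((contDiff_childProd τ v).comp contDiff_snd)

variable {s : ℕ} (m : RKMethod s)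

theorem sum_smul_testField (τ : RTree) (n : τ.Node → ℕ) (h : ℝ) (β : Fin s → ℝ) :
    h • ∑ j, β j • testField τ n (m.c j * h, testStage m.tab m.c h (m.tab j) τ n) =
      ((∑ j, β j) * h, testStage m.tab m.c h β τ n) := by
  refine Prod.ext ?_ ?_
  · simp [testField, Prod.fst_sum, mul_comm]
  · funext v
    refine Eq.trans ?_ (testStage_eq m.tab m.c h β τ n v).symm
    simp [testField, Prod.snd_sum]

/-- The clock component of stage `i` is `c_i h` because of the row sum condition; this is what makes
the nodes `c_i` appear in the moments. -/
theorem stage_testField (τ : RTree) (n : τ.Node → ℕ) (h : ℝ) (i : Fin s) :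
    m.stage (testField τ n) h 0 i = (m.c i * h, testStage m.tab m.c h (m.tab i) τ n) := by
  induction i using WellFoundedLT.induction with
  | ind i ih =>
    rw [m.stage_eq, zero_add, ← m.sum_tab i, ← sum_smul_testField]
    congr 1
    refine Finset.sum_congr rfl fun j _ => ?_
    by_cases hj : j < i
    · rw [ih j hj]
    · simp [m.tab_eq_zero hj]

theorem step_testField (τ : RTree) (n : τ.Node → ℕ) (h : ℝ) :
    m.step (testField τ n) h 0 = ((∑ j, m.b j) * h, testStage m.tab m.c h m.b τ n) := by
  simp only [RKMethod.step, stage_testField, zero_add, sum_smul_testField]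

/-- The order conditions. -/
theorem _root_.Lawson.RKMethod.HasOrder.moment_eq {m : RKMethod s} {p : ℕ} (hp : m.HasOrder p)
    (τ : RTree) (n : τ.Node → ℕ) (hn : weight τ n ≤ p) :
    moment m.tab m.c τ n m.b = simplexMoment τ n := by
  have hy0 : ((0 : ℝ), testSolution τ n 0) = 0 :=
    Prod.ext rfl (funext fun v => testSolution_zero τ n v)
  obtain ⟨C, h₁, hh₁, hC⟩ := hp.finiteDimensional (contDiff_testField τ n)
    (y := fun t => (t, testSolution τ n t)) zero_lt_one fun t _ =>
      ((hasDerivAt_id t).prodMk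
        (hasDerivAt_pi.2 fun v => hasDerivAt_testSolution τ n v t)).hasDerivWithinAt
  simp only [hy0, step_testField] at hC
  -- The root components of exact and numerical solution differ by `h ^ weight` times a constant. As
  -- the weight is at most `p`, a local error `O(h^(p+1))` leaves at least one spare factor `h`, and
  -- `h → 0` kills the constant.
  have key : ∀ h ∈ Ioc 0 (min h₁ 1), |simplexMoment τ n - moment m.tab m.c τ n m.b| ≤ C * h := by
    intro h hh
    have hh0 : 0 < h := hh.1
    have h1 := hC h ⟨hh.1, hh.2.trans (min_le_left _ _)⟩
    have h2 : |rootVal τ (testSolution τ n h) - rootVal τ (testStage m.tab m.c h m.b τ n)| ≤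
        C * h ^ (p + 1) := by
      refine le_trans ?_ ((norm_snd_le _).trans h1)
      cases τ
      exact norm_le_pi_norm (testSolution _ n h - testStage m.tab m.c h m.b _ n) none
    rw [rootVal_testSolution, rootVal_testStage, mul_comm, ← mul_sub, abs_mul,
      abs_of_pos (pow_pos hh0 _)] at h2
    have hC0 : 0 ≤ C := by
      by_contra hC0
      have : C * h ^ (p + 1) < 0 := mul_neg_of_neg_of_pos (not_le.1 hC0) (by positivity)
      exact absurd ((norm_nonneg _).trans h1) (not_le.2 this)
    have h3 : C * h ^ (p + 1) ≤ h ^ weight τ n * (C * h) := by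
      rw [mul_comm (h ^ _), mul_assoc, ← pow_succ']
      exact mul_le_mul_of_nonneg_left
        (pow_le_pow_of_le_one hh0.le (hh.2.trans (min_le_right _ _)) (by omega)) hC0
    exact le_of_mul_le_mul_left (h2.trans h3) (pow_pos hh0 _)
  have hlim : Tendsto (fun h : ℝ => C * h) (𝓝[>] 0) (𝓝 0) := by
    have : Tendsto (fun h : ℝ => C * h) (𝓝 0) (𝓝 (C * 0)) := tendsto_id.const_mul C
    rw [mul_zero] at this
    exact this.mono_left nhdsWithin_le_nhds
  have hle := ge_of_tendsto hlim (Filter.mem_of_superset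
    (Ioc_mem_nhdsGT (lt_min hh₁ zero_lt_one)) key)
  exact (sub_eq_zero.1 (abs_nonpos_iff.1 hle)).symm

end RTree

/-! ### The composition of Euler steps -/

theorem abs_prod_sub_prod_le {κ : Type*} (s : Finset κ) {x y : κ → ℝ}
    (hx : ∀ l ∈ s, x l ∈ Icc (0 : ℝ) 1) (hy : ∀ l ∈ s, y l ∈ Icc (0 : ℝ) 1) :
    |∏ l ∈ s, x l - ∏ l ∈ s, y l| ≤ ∑ l ∈ s, |x l - y l| := by
  classical
  induction s using Finset.induction_on with
  | empty => simp
  | insert l s hl ih =>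
    have ih' := ih (fun k hk => hx k (Finset.mem_insert_of_mem hk))
      (fun k hk => hy k (Finset.mem_insert_of_mem hk))
    have hxl := hx l (Finset.mem_insert_self _ _)
    have hP0 : 0 ≤ ∏ k ∈ s, y k :=
      Finset.prod_nonneg fun k hk => (hy k (Finset.mem_insert_of_mem hk)).1
    have hP1 : ∏ k ∈ s, y k ≤ 1 :=
      Finset.prod_le_one (fun k hk => (hy k (Finset.mem_insert_of_mem hk)).1)
        fun k hk => (hy k (Finset.mem_insert_of_mem hk)).2
    rw [Finset.prod_insert hl, Finset.prod_insert hl, Finset.sum_insert hl]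
    calc |x l * ∏ k ∈ s, x k - y l * ∏ k ∈ s, y k|
        = |x l * (∏ k ∈ s, x k - ∏ k ∈ s, y k) + (x l - y l) * ∏ k ∈ s, y k| := by ring_nf
      _ ≤ |x l| * |∏ k ∈ s, x k - ∏ k ∈ s, y k| + |x l - y l| * |∏ k ∈ s, y k| := by
          rw [← abs_mul, ← abs_mul]; exact abs_add_le _ _
      _ ≤ 1 * (∑ k ∈ s, |x k - y k|) + |x l - y l| * 1 := by
          gcongr
          · rw [abs_of_nonneg hxl.1]; exact hxl.2
          · rw [abs_of_nonneg hP0]; exact hP1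
      _ = _ := by ring

/-- By monotonicity the integral lies between the left and right sums, which, before scaling by `N ^
(q + 1)`, differ by at most `i ^ q ≤ N ^ q`. -/
theorem abs_riemannSum_pow_sub_le (q : ℕ) {N i : ℕ} (hN : 0 < N) (hi : i ≤ N) :
    |∑ j ∈ Finset.range i, (1 / N : ℝ) * (j / N) ^ q - (i / N) ^ (q + 1) / (q + 1 : ℕ)| ≤
      1 / N := by
  have hN' : (0 : ℝ) < N := by exact_mod_cast hN
  have hmono : MonotoneOn (fun x : ℝ => x ^ q) (Icc ((0 : ℕ) : ℝ) (i : ℕ)) := fun x hx y hy hxy =>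
    pow_le_pow_left₀ (by simpa using hx.1) hxy q
  have h1 := hmono.sum_le_integral_Ico (Nat.zero_le i)
  have h2 := hmono.integral_le_sum_Ico (Nat.zero_le i)
  rw [integral_pow] at h1 h2
  simp only [Nat.Ico_zero_eq_range, Nat.cast_zero, zero_pow (Nat.succ_ne_zero q), sub_zero]
    at h1 h2
  have h3 : ∑ j ∈ Finset.range i, ((j + 1 : ℕ) : ℝ) ^ q ≤
      ∑ j ∈ Finset.range i, (j : ℝ) ^ q + (i : ℝ) ^ q := by
    have := Finset.sum_range_succ' (fun j : ℕ => (j : ℝ) ^ q) i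
    rw [Finset.sum_range_succ] at this
    rw [this]
    exact le_add_of_nonneg_right (by positivity)
  have e1 : ∑ j ∈ Finset.range i, (1 / N : ℝ) * (j / N) ^ q =
      (∑ j ∈ Finset.range i, (j : ℝ) ^ q) / N ^ (q + 1) := by
    rw [Finset.sum_div]
    refine Finset.sum_congr rfl fun j _ => ?_
    rw [div_pow, pow_succ]
    field_simp
  have e2 : ((i : ℝ) / N) ^ (q + 1) / (q + 1 : ℕ) = ((i : ℝ) ^ (q + 1) / (q + 1)) / N ^ (q + 1) := by
    push_cast
    rw [div_pow, div_right_comm]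
  have h4 : (i : ℝ) ^ q ≤ N ^ q := pow_le_pow_left₀ (by positivity) (by exact_mod_cast hi) q
  rw [e1, e2, ← sub_div, abs_div, abs_of_pos (pow_pos hN' _), div_le_div_iff₀ (by positivity) hN',
    pow_succ (N : ℝ), one_mul]
  refine mul_le_mul_of_nonneg_right ?_ hN'.le
  rw [abs_le]
  constructor <;> linarith

/-- `N` Euler steps of length `1 / N`, regarded as one step of an `N`-stage method. -/
def eulerMethod (N : ℕ) : RKMethod N where
  a _ _ := 1 / N
  b _ := 1 / N
  c i := i / N
  row_sum i := by
    rw [Finset.sum_const, Fin.card_Iio, nsmul_eq_mul]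
    ring

/-- The coefficients of the approximation at the time `i / N`. -/
def eulerRow (N i : ℕ) (j : Fin N) : ℝ := if (j : ℕ) < i then 1 / N else 0

/-- The step is thus the row after the last stage, so stages and step are handled by the single
family `eulerRow N i`, `i ≤ N`. -/
theorem eulerMethod_b {N : ℕ} : (eulerMethod N).b = eulerRow N N := by
  funext j
  exact (if_pos j.2).symm

theorem sum_eulerRow_mul {X : Type*} [AddCommGroup X] [Module ℝ X] {N i : ℕ} (hi : i ≤ N)
    (F : ℕ → X) : ∑ j : Fin N, eulerRow N i j • F j = ∑ j ∈ Finset.range i, (1 / N : ℝ) • F j := by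
  unfold eulerRow
  rw [Fin.sum_univ_eq_sum_range (fun j => (if j < i then (1 / N : ℝ) else 0) • F j) N]
  have : (Finset.range N).filter (· < i) = Finset.range i := by
    ext j
    simp only [Finset.mem_filter, Finset.mem_range]
    omega
  rw [← this, Finset.sum_filter]
  refine Finset.sum_congr rfl fun j _ => ?_
  split_ifs <;> simp

theorem eulerRow_nonneg (N i : ℕ) (j : Fin N) : 0 ≤ eulerRow N i j := by
  unfold eulerRow
  split_ifs <;> positivity

theorem sum_eulerRow_le {N i : ℕ} (hi : i ≤ N) : ∑ j, eulerRow N i j ≤ 1 := by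
  have := sum_eulerRow_mul hi (fun _ => (1 : ℝ))
  simp only [smul_eq_mul, mul_one, Finset.sum_const, Finset.card_range, nsmul_eq_mul] at this
  rw [this, mul_one_div]
  exact div_le_one_of_le₀ (by exact_mod_cast hi) (by positivity)

theorem eulerMethod_c_mem {N : ℕ} (i : Fin N) : (eulerMethod N).c i ∈ Icc (0 : ℝ) 1 :=
  ⟨by simp only [eulerMethod]; positivity,
    div_le_one_of_le₀ (by exact_mod_cast i.2.le) (by positivity)⟩

namespace RTree

theorem moment_eulerRow_mem {N i : ℕ} (hi : i ≤ N) (τ : RTree) (n : τ.Node → ℕ) :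
    moment (eulerMethod N).tab (eulerMethod N).c τ n (eulerRow N i) ∈ Icc (0 : ℝ) 1 := by
  have := moment_nonneg_le (a := (eulerMethod N).tab) (c := (eulerMethod N).c) le_rfl
    (fun i => eulerRow_nonneg N i) (fun i => sum_eulerRow_le i.2.le) eulerMethod_c_mem τ n
    (eulerRow N i) (eulerRow_nonneg N i) (sum_eulerRow_le hi)
  rwa [one_pow] at this

/-- Induction on the tree: the branches at stage `j` are within `O(1/N)` of multiples of powers of
`j / N`, so the root sum is close to a Riemann sum of a power. All `i ≤ N` are needed because
branches are evaluated at intermediate times. -/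
theorem exists_moment_eulerRow_le : ∀ (τ : RTree) (n : τ.Node → ℕ), ∃ C : ℝ, ∀ N i : ℕ, 0 < N →
    i ≤ N → |moment (eulerMethod N).tab (eulerMethod N).c τ n (eulerRow N i) -
      simplexMoment τ n * (i / N : ℝ) ^ weight τ n| ≤ C / N
  | node k τ, n => by
    choose C hC using fun l => exists_moment_eulerRow_le (τ l) (branch n l)
    refine ⟨∑ l, C l + 1, fun N i hN hi => ?_⟩
    have hN' : (0 : ℝ) < N := by exact_mod_cast hN
    set a := (eulerMethod N).tab
    set c := (eulerMethod N).c
    set P : ℝ := ∏ l, simplexMoment (τ l) (branch n l)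
    set q : ℕ := atRoot n + ∑ l, weight (τ l) (branch n l)
    have hP : P ∈ Icc (0 : ℝ) 1 :=
      ⟨Finset.prod_nonneg fun l _ => (simplexMoment_mem (τ l) _).1,
        Finset.prod_le_one (fun l _ => (simplexMoment_mem (τ l) _).1)
          fun l _ => (simplexMoment_mem (τ l) _).2⟩
    have hw : weight (node k τ) n = q + 1 := by rw [weight]; omega
    have hsum : ∀ j : Fin N, |c j ^ atRoot n * ∏ l, moment a c (τ l) (branch n l) (a j) -
        P * (j / N : ℝ) ^ q| ≤ (∑ l, C l) / N := by
      intro j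
      have hj : (j / N : ℝ) ∈ Icc (0 : ℝ) 1 := eulerMethod_c_mem j
      have e : P * (j / N : ℝ) ^ q = (j / N : ℝ) ^ atRoot n *
          ∏ l, (simplexMoment (τ l) (branch n l) * (j / N : ℝ) ^ weight (τ l) (branch n l)) := by
        rw [Finset.prod_mul_distrib, Finset.prod_pow_eq_pow_sum, pow_add]
        ring
      rw [e]
      change |(j / N : ℝ) ^ atRoot n * _ - _| ≤ _
      rw [← mul_sub, abs_mul, abs_of_nonneg (pow_nonneg hj.1 _), Finset.sum_div]
      refine (mul_le_of_le_one_left (abs_nonneg _) (pow_le_one₀ hj.1 hj.2)).trans ?_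
      refine (abs_prod_sub_prod_le _ (fun l _ => moment_eulerRow_mem j.2.le (τ l) _)
        fun l _ => ?_).trans (Finset.sum_le_sum fun l _ => hC l N j hN j.2.le)
      have h1 := simplexMoment_mem (τ l) (branch n l)
      exact ⟨mul_nonneg h1.1 (pow_nonneg hj.1 _),
        mul_le_one₀ h1.2 (pow_nonneg hj.1 _) (pow_le_one₀ hj.1 hj.2)⟩
    have hC0 : 0 ≤ (∑ l, C l) / N := by
      rw [Finset.sum_div]
      exact Finset.sum_nonneg fun l _ => (abs_nonneg _).trans (hC l N 0 hN (Nat.zero_le _))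
    have hR := abs_riemannSum_pow_sub_le q hN hi
    have hrow := sum_eulerRow_mul hi (fun j => (j / N : ℝ) ^ q)
    simp only [smul_eq_mul] at hrow
    rw [← hrow] at hR
    have e3 : simplexMoment (node k τ) n * (i / N : ℝ) ^ weight (node k τ) n =
        P * ((i / N : ℝ) ^ (q + 1) / (q + 1 : ℕ)) := by
      rw [simplexMoment, hw]
      ring
    have e4 : moment a c (node k τ) n (eulerRow N i) -
        P * ((i / N : ℝ) ^ (q + 1) / (q + 1 : ℕ)) =
        ∑ j, eulerRow N i j * (c j ^ atRoot n * ∏ l, moment a c (τ l) (branch n l) (a j) -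
          P * (j / N : ℝ) ^ q) +
        P * (∑ j : Fin N, eulerRow N i j * (j / N : ℝ) ^ q -
          (i / N : ℝ) ^ (q + 1) / (q + 1 : ℕ)) := by
      rw [moment, mul_sub, Finset.mul_sum]
      simp only [mul_sub, Finset.sum_sub_distrib]
      have : ∀ j : Fin N, eulerRow N i j * (P * (j / N : ℝ) ^ q) =
        P * (eulerRow N i j * (j / N : ℝ) ^ q) := fun j => by ring
      simp only [this]
      ring
    rw [e3, e4, add_div]
    refine (abs_add_le _ _).trans (add_le_add ?_ ?_)
    · refine (Finset.abs_sum_le_sum_abs _ _).trans ?_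
      calc _ ≤ ∑ j, eulerRow N i j * ((∑ l, C l) / N) := by
            refine Finset.sum_le_sum fun j _ => ?_
            rw [abs_mul, abs_of_nonneg (eulerRow_nonneg N i j)]
            exact mul_le_mul_of_nonneg_left (hsum j) (eulerRow_nonneg N i j)
        _ ≤ _ := by
            rw [← Finset.sum_mul]
            exact mul_le_of_le_one_left hC0 (sum_eulerRow_le hi)
    · rw [abs_mul, abs_of_nonneg hP.1]
      exact (mul_le_of_le_one_left (abs_nonneg _) hP.2).trans hR

theorem tendsto_moment_eulerMethod (τ : RTree) (n : τ.Node → ℕ) :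
    Tendsto (fun N : ℕ => moment (eulerMethod N).tab (eulerMethod N).c τ n (eulerMethod N).b)
      atTop (𝓝 (simplexMoment τ n)) := by
  obtain ⟨C, hC⟩ := exists_moment_eulerRow_le τ n
  rw [tendsto_iff_norm_sub_tendsto_zero]
  refine squeeze_zero' (.of_forall fun _ => norm_nonneg _) ?_
    (tendsto_const_div_atTop_nhds_zero_nat C)
  filter_upwards [eventually_gt_atTop 0] with N hN
  have hN' : (N : ℝ) ≠ 0 := by exact_mod_cast hN.ne'
  have := hC N N hN le_rfl
  rwa [div_self hN', one_pow, mul_one, ← eulerMethod_b] at this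

end RTree

/-! ### Taylor expansions -/

section Taylor

variable {E X : Type*} [NormedAddCommGroup E] [NormedSpace ℝ E] [NormedAddCommGroup X]
  [NormedSpace ℝ X]

/-- The remainder vanishes at `0` and its derivative is the remainder for the shifted sequence, so
the mean value inequality gives the induction. The free `c` serves two uses: `c = 0` for a bounded
top derivative, `c = φ n 0` for a Lipschitz one. -/
theorem norm_sub_taylor_le (n : ℕ) : ∀ (φ : ℕ → ℝ → X) {c : X} {C : ℝ},
    (∀ k < n, ∀ t ∈ Icc (0 : ℝ) 1, HasDerivWithinAt (φ k) (φ (k + 1) t) (Icc 0 1) t) →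
    (∀ t ∈ Icc (0 : ℝ) 1, ‖φ n t - c‖ ≤ C) → ∀ t ∈ Icc (0 : ℝ) 1,
      ‖φ 0 t - (∑ k ∈ Finset.range n, (t ^ k / k.factorial : ℝ) • φ k 0 +
        (t ^ n / n.factorial : ℝ) • c)‖ ≤ C := by
  induction n with
  | zero => intro φ c C _ hC t ht; simpa using hC t ht
  | succ n ih =>
    intro φ c C hφ hC t ht
    have ih' := ih (fun k => φ (k + 1)) (fun k hk => hφ (k + 1) (by omega)) hC
    have hmono : ∀ (k : ℕ) (x : X) (t : ℝ), HasDerivWithinAt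
        (fun t : ℝ => (t ^ (k + 1) / (k + 1).factorial : ℝ) • x) ((t ^ k / k.factorial : ℝ) • x)
        (Icc 0 1) t := by
      intro k x t
      refine HasDerivAt.hasDerivWithinAt (HasDerivAt.smul_const ?_ x)
      refine ((hasDerivAt_pow (k + 1) t).div_const _).congr_deriv ?_
      have h1 : (k.factorial : ℝ) ≠ 0 := by exact_mod_cast k.factorial_ne_zero
      rw [Nat.factorial_succ]
      push_cast
      field_simp
    have hd : ∀ t ∈ Icc (0 : ℝ) 1, HasDerivWithinAt
        (fun t => φ 0 t - (∑ k ∈ Finset.range n, (t ^ (k + 1) / (k + 1).factorial : ℝ) • φ (k + 1) 0 +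
          (t ^ (n + 1) / (n + 1).factorial : ℝ) • c))
        (φ 1 t - (∑ k ∈ Finset.range n, (t ^ k / k.factorial : ℝ) • φ (k + 1) 0 +
          (t ^ n / n.factorial : ℝ) • c)) (Icc 0 1) t := fun t ht =>
      (hφ 0 (by omega) t ht).sub
        ((HasDerivWithinAt.fun_sum fun k _ => hmono k _ t).add (hmono n c t))
    have h1 := Convex.norm_image_sub_le_of_norm_hasDerivWithin_le hd ih' (convex_Icc 0 1)
      (left_mem_Icc.2 zero_le_one) ht
    have hC0 : 0 ≤ C := (norm_nonneg _).trans (hC t ht)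
    refine le_trans (le_of_eq ?_) (h1.trans (mul_le_of_le_one_right hC0 ?_))
    · rw [Finset.sum_range_succ']
      simp only [ne_eq, Nat.succ_ne_zero, not_false_eq_true, zero_pow, zero_div, zero_smul,
        Finset.sum_const_zero, add_zero, sub_zero, pow_zero, Nat.factorial_zero, Nat.cast_one,
        div_one, one_smul]
      congr 1
      abel
    · rw [sub_zero, Real.norm_eq_abs, abs_of_nonneg ht.1]
      exact ht.2

theorem norm_sub_taylor_fderiv_le {n : ℕ} {g : E → X} {U : Set E} {B : ℝ} {x δ : E}
    (hU : IsOpen U) (hg : ∀ k < n, DifferentiableOn ℝ (iteratedFDeriv ℝ k g) U)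
    (hB : ∀ z ∈ U, ‖iteratedFDeriv ℝ n g z‖ ≤ B)
    (hx : ∀ t ∈ Icc (0 : ℝ) 1, x + t • δ ∈ U) :
    ‖g (x + δ) - ∑ k ∈ Finset.range n,
      (1 / k.factorial : ℝ) • iteratedFDeriv ℝ k g x (fun _ => δ)‖ ≤ B * ‖δ‖ ^ n := by
  have h := norm_sub_taylor_le n (fun k t => iteratedFDeriv ℝ k g (x + t • δ) fun _ => δ)
    (c := 0) (C := B * ‖δ‖ ^ n) ?_ ?_ 1 (right_mem_Icc.2 zero_le_one)
  · simpa using h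
  · intro k hk t ht
    have h1 : HasDerivAt (fun t : ℝ => x + t • δ) δ t := by
      simpa using ((hasDerivAt_id t).smul_const δ).const_add x
    have h2 := ((hg k hk).differentiableAt (hU.mem_nhds (hx t ht))).hasFDerivAt.comp_hasDerivAt t h1
    have h3 := (ContinuousMultilinearMap.apply ℝ (fun _ : Fin k => E) X
      fun _ => δ).hasFDerivAt.comp_hasDerivAt t h2
    exact h3.hasDerivWithinAt
  · intro t ht
    rw [sub_zero]
    refine (ContinuousMultilinearMap.le_opNorm _ _).trans ?_
    rw [Finset.prod_const, Finset.card_fin]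
    exact mul_le_mul_of_nonneg_right (hB _ (hx t ht)) (by positivity)

theorem IsCkLip.norm_sub_taylor_le {n : ℕ} {L : ℝ} {f : E → X} {D : Set E}
    (hf : IsCkLip n L f D) (hL : 0 ≤ L) (hD : Convex ℝ D) (hU : UniqueDiffOn ℝ D)
    (h0 : (0 : E) ∈ D) {x : E} (hx : x ∈ D) :
    ‖f x - ∑ k ∈ Finset.range (n + 1), (1 / k.factorial : ℝ) •
      iteratedFDerivWithin ℝ k f D 0 (fun _ => x)‖ ≤ L * ‖x‖ ^ (n + 1) := by
  have hmem : ∀ t ∈ Icc (0 : ℝ) 1, t • x ∈ D := fun t ht =>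
    hD.smul_mem_of_zero_mem h0 hx ht
  have h := Lawson.norm_sub_taylor_le n
    (fun k t => iteratedFDerivWithin ℝ k f D (t • x) fun _ => x)
    (c := iteratedFDerivWithin ℝ n f D 0 fun _ => x) (C := L * ‖x‖ ^ (n + 1)) ?_ ?_ 1
    (right_mem_Icc.2 zero_le_one)
  · simpa [Finset.sum_range_succ] using h
  · intro k hk t ht
    have h1 : HasDerivWithinAt (fun t : ℝ => t • x) x (Icc 0 1) t := by
      simpa using ((hasDerivAt_id t).smul_const x).hasDerivWithinAt
    have h2 := ((hf.1.differentiableOn_iteratedFDerivWithin (by exact_mod_cast hk) hU) _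
      (hmem t ht)).hasFDerivWithinAt.comp_hasDerivWithinAt t h1 hmem
    exact (ContinuousMultilinearMap.apply ℝ (fun _ : Fin k => E) X
      fun _ => x).hasFDerivAt.comp_hasDerivWithinAt t h2
  · intro t ht
    rw [← sub_apply]
    refine (ContinuousMultilinearMap.le_opNorm _ _).trans ?_
    rw [Finset.prod_const, Finset.card_fin, pow_succ', ← mul_assoc]
    refine mul_le_mul_of_nonneg_right ((hf.2 _ (hmem t ht) _ h0).trans ?_) (by positivity)
    rw [sub_zero, norm_smul, Real.norm_eq_abs, abs_of_nonneg ht.1]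
    exact mul_le_mul_of_nonneg_left (mul_le_of_le_one_left (norm_nonneg _) ht.2) hL

variable {ν : Type*} [Fintype ν]

theorem multilinear_apply_eq_sum_monomials [DecidableEq ν] {k : ℕ}
    (A : (ν → ℝ) [×k]→L[ℝ] X) (x : ν → ℝ) :
    A (fun _ => x) = ∑ f : Fin k → ν, (∏ i, x (f i)) • A fun i => Pi.single (f i) 1 := by
  conv_lhs => rw [pi_eq_sum_univ' x]
  rw [A.map_sum]
  exact Finset.sum_congr rfl fun f _ => A.map_smul_univ _ _

/-- `F` is approximated on `D`, up to the error `ε`, by a polynomial of degree `n` in the coordinates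
with coefficients in `X`. -/
def PolyApprox (n : ℕ) (ε : ℝ) (F : (ν → ℝ) → X) (D : Set (ν → ℝ)) : Prop :=
  ∃ d : ∀ k : ℕ, (Fin k → ν) → X, ∀ x ∈ D,
    ‖F x - ∑ k ∈ Finset.range (n + 1), ∑ f : Fin k → ν, (∏ i, x (f i)) • d k f‖ ≤ ε

/-- The Taylor polynomial at the origin. The smaller set `D'` allows approximation on a shrunken
cube, where `‖x‖` is small. -/
theorem IsCkLip.polyApprox {n : ℕ} {L ε : ℝ} {F : (ν → ℝ) → X} {D D' : Set (ν → ℝ)}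
    (hf : IsCkLip n L F D) (hL : 0 ≤ L) (hD : Convex ℝ D) (hU : UniqueDiffOn ℝ D)
    (h0 : (0 : ν → ℝ) ∈ D) (hD' : D' ⊆ D) (hε : ∀ x ∈ D', L * ‖x‖ ^ (n + 1) ≤ ε) :
    PolyApprox n ε F D' := by
  classical
  refine ⟨fun k f => (1 / k.factorial : ℝ) • iteratedFDerivWithin ℝ k F D 0
    fun i => Pi.single (f i) 1, fun x hx => ?_⟩
  refine le_trans (le_of_eq ?_)
    ((hf.norm_sub_taylor_le hL hD hU h0 (hD' hx)).trans (hε x hx))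
  congr 2
  refine Finset.sum_congr rfl fun k _ => ?_
  rw [multilinear_apply_eq_sum_monomials, Finset.smul_sum]
  exact Finset.sum_congr rfl fun f _ => smul_comm _ _ _

end Taylor

/-! ### Truncated tree expansions -/

/-- Trees of height at most `q` in which a node of height `i` has less than `i` children. -/
def TruncTree : ℕ → Type
  | 0 => Empty
  | q + 1 => Σ k : Fin (q + 1), (Fin k → TruncTree q)

namespace TruncTree

instance instFintype : (q : ℕ) → Fintype (TruncTree q)
  | 0 => inferInstanceAs (Fintype Empty)
  | q + 1 =>
    letI := instFintype q
    inferInstanceAs (Fintype (Σ k : Fin (q + 1), (Fin k → TruncTree q)))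

/-- The underlying rooted tree. -/
def toTree : (q : ℕ) → TruncTree q → RTree
  | 0, x => nomatch x
  | q + 1, ⟨k, x⟩ => RTree.node k fun l => toTree q (x l)

theorem sum_succ {M : Type*} [AddCommMonoid M] (q : ℕ) (F : RTree → M) :
    ∑ x : TruncTree (q + 1), F (toTree _ x) =
      ∑ k ∈ Finset.range (q + 1), ∑ x : Fin k → TruncTree q,
        F (RTree.node k fun l => toTree q (x l)) := by
  rw [Finset.sum_range fun k => ∑ x : Fin k → TruncTree q,
        F (RTree.node k fun l => toTree q (x l))]
  exact Fintype.sum_sigma (α := fun k : Fin (q + 1) => Fin k → TruncTree q)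
    fun x => F (RTree.node x.1 fun l => toTree q (x.2 l))

end TruncTree

/-- The coefficient of the elementary integral of a tree in the expansion of the solution. -/
def RTree.coeff : RTree → ℝ
  | node k τ => (1 / k.factorial : ℝ) * ∏ l, (τ l).coeff

section Expansion

variable {ι X : Type*} [Fintype ι] [NormedAddCommGroup X] [NormedSpace ℝ X]

/-- The elementary quadrature of a tree for operator valued coefficients `T`, the root carrying the
coefficients `R`; `L k j` plays the role of the `k`-th derivative at the `j`-th stage. -/
def elementary (T : ι → ι → X →L[ℝ] X) (L : ∀ k : ℕ, ι → X [×k]→L[ℝ] X) :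
    RTree → (ι → X →L[ℝ] X) → X
  | .node k τ, R => ∑ j, R j (L k j fun l => elementary T L (τ l) (T j))

/-- The truncated tree expansion of the increment. -/
def truncSum (T : ι → ι → X →L[ℝ] X) (L : ∀ k : ℕ, ι → X [×k]→L[ℝ] X) (h : ℝ) (q : ℕ)
    (R : ι → X →L[ℝ] X) : X :=
  ∑ x : TruncTree q, ((TruncTree.toTree q x).coeff * h ^ (TruncTree.toTree q x).order) •
    elementary T L (TruncTree.toTree q x) R

variable {T : ι → ι → X →L[ℝ] X} {L : ∀ k : ℕ, ι → X [×k]→L[ℝ] X} {h K B : ℝ}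

theorem truncSum_zero (R : ι → X →L[ℝ] X) : truncSum T L h 0 R = 0 :=
  Fintype.sum_empty (ι := Empty) _

/-- Multilinearity turns the tree sum into one Picard step: the expansion of level `q` is inserted
into a Taylor polynomial of degree `q`. -/
theorem truncSum_succ (q : ℕ) (R : ι → X →L[ℝ] X) :
    truncSum T L h (q + 1) R = h • ∑ j, R j (∑ k ∈ Finset.range (q + 1),
      (1 / k.factorial : ℝ) • L k j fun _ => truncSum T L h q (T j)) := by
  have h1 : ∀ j, ∀ k, (L k j fun _ => truncSum T L h q (T j)) = ∑ x : Fin k → TruncTree q,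
      (∏ l, ((TruncTree.toTree q (x l)).coeff * h ^ (TruncTree.toTree q (x l)).order)) •
        L k j fun l => elementary T L (TruncTree.toTree q (x l)) (T j) := by
    intro j k
    simp only [truncSum]
    rw [ContinuousMultilinearMap.map_sum]
    exact Finset.sum_congr rfl fun x _ => ContinuousMultilinearMap.map_smul_univ _ _ _
  rw [truncSum, TruncTree.sum_succ q fun τ => (τ.coeff * h ^ τ.order) • elementary T L τ R]
  simp only [h1, map_sum, map_smul, Finset.smul_sum]
  rw [Finset.sum_comm]
  refine Finset.sum_congr rfl fun k _ => ?_
  rw [Finset.sum_comm]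
  refine Finset.sum_congr rfl fun x _ => ?_
  rw [elementary, Finset.smul_sum]
  refine Finset.sum_congr rfl fun j _ => ?_
  rw [smul_smul, smul_smul]
  congr 1
  rw [RTree.coeff, RTree.order, pow_add, Finset.prod_mul_distrib, Finset.prod_pow_eq_pow_sum]
  ring

theorem norm_sum_apply_le {R : ι → X →L[ℝ] X} {y : ι → X} {b : ℝ} (hR : ∑ j, ‖R j‖ ≤ K)
    (hb : 0 ≤ b) (hy : ∀ j, ‖y j‖ ≤ b) : ‖∑ j, R j (y j)‖ ≤ K * b :=
  calc ‖∑ j, R j (y j)‖ ≤ ∑ j, ‖R j‖ * b := norm_sum_le_of_le _ fun j _ =>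
        (R j).le_of_opNorm_le_of_le le_rfl (hy j)
    _ ≤ K * b := by
        rw [← Finset.sum_mul]
        exact mul_le_mul_of_nonneg_right hR hb

/-- A crude size bound, enough for the trees of order above `p` that occur in the truncated sum:
there `h ^ order` is already `O(h^(p+1))`. -/
theorem norm_elementary_le {p : ℕ} {G : ℝ} (hT : ∀ i, ∑ j, ‖T i j‖ ≤ K) (hB : 0 ≤ B)
    (hL : ∀ k < p, ∀ j, ‖L k j‖ ≤ B) (hK : 0 ≤ K) (hG : K * B ≤ G) :
    ∀ q ≤ p, ∀ (x : TruncTree q) (R : ι → X →L[ℝ] X), ∑ j, ‖R j‖ ≤ K →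
      ‖elementary T L (TruncTree.toTree q x) R‖ ≤ G ^ (TruncTree.toTree q x).order
  | 0, _, x, _, _ => nomatch x
  | q + 1, hq, ⟨k, x⟩, R, hR => by
    have ih := fun l j => norm_elementary_le hT hB hL hK hG q (by omega) (x l) (T j) (hT j)
    have hG0 : 0 ≤ G := (mul_nonneg hK hB).trans hG
    rw [TruncTree.toTree, elementary, RTree.order, pow_add, pow_one]
    refine (norm_sum_apply_le hR (mul_nonneg hB (pow_nonneg hG0 _)) fun j => ?_).trans
      (le_of_eq_of_le (mul_assoc _ _ _).symm (mul_le_mul_of_nonneg_right hG (pow_nonneg hG0 _)))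
    refine (ContinuousMultilinearMap.le_opNorm _ _).trans
      (mul_le_mul (hL k (by omega) j) ?_ (by positivity) hB)
    rw [← Finset.prod_pow_eq_pow_sum]
    exact Finset.prod_le_prod (fun _ _ => norm_nonneg _) fun l _ => ih l j

theorem norm_truncSum_le {p : ℕ} (hh : 0 ≤ h) (hK : 0 ≤ K) (hB : 0 ≤ B)
    (hT : ∀ i, ∑ j, ‖T i j‖ ≤ K) (hL : ∀ k < p, ∀ j, ‖L k j‖ ≤ B) (hsmall : h * (K * (B * p)) ≤ 1) :
    ∀ q ≤ p, ∀ R : ι → X →L[ℝ] X, ∑ j, ‖R j‖ ≤ K → ‖truncSum T L h q R‖ ≤ 1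
  | 0, _, R, _ => by rw [truncSum_zero, norm_zero]; exact zero_le_one
  | q + 1, hq, R, hR => by
    have ih := norm_truncSum_le hh hK hB hT hL hsmall q (by omega)
    rw [truncSum_succ, norm_smul, Real.norm_of_nonneg hh]
    refine le_trans (mul_le_mul_of_nonneg_left (norm_sum_apply_le hR (b := B * p)
      (by positivity) fun j => ?_) hh) hsmall
    refine (norm_sum_le_of_le (f := fun k => (1 / k.factorial : ℝ) • L k j fun _ =>
      truncSum T L h q (T j)) _ (n := fun _ => B) fun k hk => ?_).trans ?_
    · have hk' : k < q + 1 := Finset.mem_range.1 hk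
      rw [norm_smul, Real.norm_of_nonneg (by positivity)]
      have h1 : (1 / k.factorial : ℝ) ≤ 1 :=
        div_le_one_of_le₀ (by exact_mod_cast k.factorial_pos) (by positivity)
      refine (mul_le_of_le_one_left (norm_nonneg _) h1).trans ?_
      refine (ContinuousMultilinearMap.le_opNorm _ _).trans ?_
      rw [Finset.prod_const]
      exact (mul_le_of_le_one_right (norm_nonneg _) (pow_le_one₀ (norm_nonneg _)
        (ih (T j) (hT j)))).trans (hL k (by omega) j)
    · rw [Finset.sum_const, Finset.card_range, nsmul_eq_mul, mul_comm]
      exact mul_le_mul_of_nonneg_left (by exact_mod_cast hq) hB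

/-- The constants in the error of the truncated expansion. -/
def truncConst (K B : ℝ) : ℕ → ℝ
  | 0 => K * B
  | q + 1 => K * (B * (K * B) ^ (q + 1) + (q + 1) * (B * q * truncConst K B q))

theorem truncConst_nonneg (hK : 0 ≤ K) (hB : 0 ≤ B) : ∀ q, 0 ≤ truncConst K B q
  | 0 => mul_nonneg hK hB
  | q + 1 => by
    have := truncConst_nonneg hK hB q
    rw [truncConst]
    positivity

/-- Each Picard step gains a power of `h`: the Taylor remainder is `O(‖δ‖^(q+1)) = O(h^(q+1))`,
replacing `δ` by the expansion of level `q` costs `O(h^(q+1))`, and the outer factor supplies one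
more `h`. -/
theorem norm_sub_truncSum_le {p : ℕ} {G δ : ι → X} (hh : 0 ≤ h) (hK : 0 ≤ K) (hB : 0 ≤ B)
    (hT : ∀ i, ∑ j, ‖T i j‖ ≤ K) (hL : ∀ k < p, ∀ j, ‖L k j‖ ≤ B)
    (hsmall : h * (K * (B * p)) ≤ 1) (hsmall' : h * (K * B) ≤ 1)
    (hδ : ∀ i, δ i = h • ∑ j, T i j (G j))
    (hG : ∀ n ≤ p, ∀ j, ‖G j - ∑ k ∈ Finset.range n,
      (1 / k.factorial : ℝ) • L k j fun _ => δ j‖ ≤ B * ‖δ j‖ ^ n) :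
    ∀ q ≤ p, ∀ R : ι → X →L[ℝ] X, ∑ j, ‖R j‖ ≤ K →
      ‖h • ∑ j, R j (G j) - truncSum T L h q R‖ ≤ truncConst K B q * h ^ (q + 1)
  | 0, _, R, hR => by
    have h0 : ∀ j, ‖G j‖ ≤ B := fun j => by simpa using hG 0 (Nat.zero_le _) j
    rw [truncSum_zero, sub_zero, norm_smul, Real.norm_of_nonneg hh, truncConst, zero_add, pow_one,
      mul_comm]
    exact mul_le_mul_of_nonneg_right (norm_sum_apply_le hR hB h0) hh
  | q + 1, hq, R, hR => by
    have ih := norm_sub_truncSum_le hh hK hB hT hL hsmall hsmall' hδ hG q (by omega)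
    have h0 : ∀ j, ‖G j‖ ≤ B := fun j => by simpa using hG 0 (Nat.zero_le _) j
    have hδn : ∀ j, ‖δ j‖ ≤ h * (K * B) := by
      intro j
      rw [hδ, norm_smul, Real.norm_of_nonneg hh]
      exact mul_le_mul_of_nonneg_left (norm_sum_apply_le (hT j) hB h0) hh
    have hC := truncConst_nonneg hK hB q
    -- Both arguments lie in the unit ball by the smallness conditions, where a `k`-linear map of
    -- norm at most `B` is Lipschitz with constant `B * k ≤ B * q`.
    have hterm : ∀ j, ∀ k ∈ Finset.range (q + 1),
        ‖(1 / k.factorial : ℝ) • (L k j fun _ => δ j) -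
          (1 / k.factorial : ℝ) • (L k j fun _ => truncSum T L h q (T j))‖ ≤
            B * q * (truncConst K B q * h ^ (q + 1)) := by
      intro j k hk
      have hk' : k < q + 1 := Finset.mem_range.1 hk
      rw [← smul_sub, norm_smul, Real.norm_of_nonneg (by positivity)]
      have h1 : (1 / k.factorial : ℝ) ≤ 1 :=
        div_le_one_of_le₀ (by exact_mod_cast k.factorial_pos) (by positivity)
      refine (mul_le_of_le_one_left (norm_nonneg _) h1).trans ?_
      refine (ContinuousMultilinearMap.norm_image_sub_le _ _ _).trans ?_
      have hn1 : ‖fun _ : Fin k => δ j‖ ≤ 1 :=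
        (pi_norm_le_iff_of_nonneg zero_le_one).2 fun _ => (hδn j).trans hsmall'
      have hn2 : ‖fun _ : Fin k => truncSum T L h q (T j)‖ ≤ 1 :=
        (pi_norm_le_iff_of_nonneg zero_le_one).2 fun _ =>
          norm_truncSum_le hh hK hB hT hL hsmall q (by omega) (T j) (hT j)
      have hn3 : ‖(fun _ : Fin k => δ j) - fun _ => truncSum T L h q (T j)‖ ≤
          truncConst K B q * h ^ (q + 1) :=
        (pi_norm_le_iff_of_nonneg (by positivity)).2 fun _ => by
          have := ih (T j) (hT j)
          rwa [← hδ] at this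
      have hkq : ((Fintype.card (Fin k) : ℕ) : ℝ) ≤ q := by
        rw [Fintype.card_fin]; exact_mod_cast Nat.lt_succ_iff.1 hk'
      refine mul_le_mul ?_ hn3 (norm_nonneg _) (by positivity)
      refine (mul_le_of_le_one_right (by positivity)
        (pow_le_one₀ (by positivity) (max_le hn1 hn2))).trans ?_
      exact mul_le_mul (hL k (by omega) j) hkq (by positivity) hB
    have hdiff : ∀ j, ‖G j - ∑ k ∈ Finset.range (q + 1),
        (1 / k.factorial : ℝ) • L k j fun _ => truncSum T L h q (T j)‖ ≤
          (B * (K * B) ^ (q + 1) + (q + 1) * (B * q * truncConst K B q)) * h ^ (q + 1) := by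
      intro j
      have h1 := hG (q + 1) hq j
      have h2 : B * ‖δ j‖ ^ (q + 1) ≤ B * (h * (K * B)) ^ (q + 1) :=
        mul_le_mul_of_nonneg_left (pow_le_pow_left₀ (norm_nonneg _) (hδn j) _) hB
      have h3 := norm_sum_le_of_le _ (hterm j)
      rw [Finset.sum_const, Finset.card_range, nsmul_eq_mul, Finset.sum_sub_distrib] at h3
      calc _ ≤ _ := norm_sub_le_norm_sub_add_norm_sub _ (∑ k ∈ Finset.range (q + 1),
            (1 / k.factorial : ℝ) • L k j fun _ => δ j) _
        _ ≤ _ := add_le_add (h1.trans h2) h3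
        _ = _ := by push_cast; rw [mul_pow]; ring
    rw [truncSum_succ, ← smul_sub, ← Finset.sum_sub_distrib, norm_smul, Real.norm_of_nonneg hh]
    simp only [← map_sub]
    refine (mul_le_mul_of_nonneg_left (norm_sum_apply_le hR (by positivity) hdiff) hh).trans
      (le_of_eq ?_)
    rw [truncConst]
    ring

end Expansion

/-! ### Elementary quadratures -/

namespace RTree

variable {X : Type*} [NormedAddCommGroup X] [NormedSpace ℝ X]

/-- The propagator on an edge depends only on the nodes at its two ends, exactly as in the recursion
for `integrand`; multilinearity then distributes the stage sums over labellings. -/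
theorem elementary_eq_sum {ι : Type*} [Fintype ι] (a : ι → ι → ℝ) (c : ι → ℝ)
    (S : ℝ → X →L[ℝ] X) (g : X → X) (h : ℝ) (w : X) :
    ∀ (τ : RTree) (β : ι → ℝ) (ζ : ℝ),
      elementary (fun i j => a i j • S ((c i - c j) * h))
        (fun k j => iteratedFDeriv ℝ k g (S (c j * h) w)) τ (fun j => β j • S ((ζ - c j) * h)) =
      ∑ φ : τ.Node → ι, treeWeight a τ β φ • integrand S g h w τ ζ (fun v => c (φ v))
  | node k τ, β, ζ => by
    have h1 : ∀ φ : (node k τ).Node → ι,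
        treeWeight a (node k τ) β φ • integrand S g h w (node k τ) ζ (fun v => c (φ v)) =
        (β (atRoot φ) * ∏ l, treeWeight a (τ l) (a (atRoot φ)) (branch φ l)) •
          S ((ζ - c (atRoot φ)) * h) (iteratedFDeriv ℝ k g (S (c (atRoot φ) * h) w)
            fun l => integrand S g h w (τ l) (c (atRoot φ)) fun v => c (branch φ l v)) :=
      fun φ => rfl
    rw [Finset.sum_congr rfl fun φ _ => h1 φ, sum_label fun j ψ =>
      (β j * ∏ l, treeWeight a (τ l) (a j) (ψ l)) • S ((ζ - c j) * h)
        (iteratedFDeriv ℝ k g (S (c j * h) w) fun l =>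
          integrand S g h w (τ l) (c j) fun v => c (ψ l v)), elementary]
    refine Finset.sum_congr rfl fun j _ => ?_
    simp only [elementary_eq_sum a c S g h w _ (a j) (c j)]
    rw [ContinuousMultilinearMap.map_sum, map_sum]
    refine Finset.sum_congr rfl fun ψ _ => ?_
    rw [ContinuousMultilinearMap.map_smul_univ, map_smul, smul_apply, smul_smul, mul_comm]

/-- The tree quadrature of a function of the node variables. -/
def quadrature {s : ℕ} (m : RKMethod s) (τ : RTree) (F : (τ.Node → ℝ) → X) : X :=
  ∑ φ : τ.Node → Fin s, treeWeight m.tab τ m.b φ • F fun v => m.c (φ v)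

/-- The number of occurrences of each node. -/
def occurrences {τ : RTree} {k : ℕ} (f : Fin k → τ.Node) (v : τ.Node) : ℕ :=
  (Finset.univ.filter fun i => f i = v).card

theorem prod_eq_prod_pow_occurrences {τ : RTree} {k : ℕ} (f : Fin k → τ.Node) (x : τ.Node → ℝ) :
    ∏ i, x (f i) = ∏ v, x v ^ occurrences f v := by
  rw [← Finset.prod_fiberwise' Finset.univ f x]
  exact Finset.prod_congr rfl fun v _ => Finset.prod_const _

theorem sum_occurrences {τ : RTree} {k : ℕ} (f : Fin k → τ.Node) : ∑ v, occurrences f v = k := by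
  have := Finset.sum_fiberwise' Finset.univ f fun _ => (1 : ℕ)
  simpa [occurrences] using this

/-- On the polynomial the quadrature is a combination of moments; the remainder is multiplied by at
most the total absolute weight. Only points of nonzero weight have to lie in `D`. -/
theorem norm_quadrature_sub_le {s : ℕ} (m : RKMethod s) {K : ℝ} (hK : 1 ≤ K)
    (ha : ∀ i, ∑ j, |m.tab i j| ≤ K) (hb : ∑ j, |m.b j| ≤ K) (τ : RTree) {n : ℕ} {ε : ℝ}
    {F : (τ.Node → ℝ) → X} {D : Set (τ.Node → ℝ)} (hε : 0 ≤ ε)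
    (hD : ∀ φ : τ.Node → Fin s, treeWeight m.tab τ m.b φ ≠ 0 → (fun v => m.c (φ v)) ∈ D)
    {d : ∀ k : ℕ, (Fin k → τ.Node) → X} (hd : ∀ x ∈ D, ‖F x - ∑ k ∈ Finset.range (n + 1),
      ∑ f : Fin k → τ.Node, (∏ i, x (f i)) • d k f‖ ≤ ε) :
    ‖quadrature m τ F - ∑ k ∈ Finset.range (n + 1), ∑ f : Fin k → τ.Node,
      moment m.tab m.c τ (occurrences f) m.b • d k f‖ ≤ K ^ τ.order * ε := by
  have h1 : ∑ k ∈ Finset.range (n + 1), ∑ f : Fin k → τ.Node,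
      moment m.tab m.c τ (occurrences f) m.b • d k f = quadrature m τ fun x =>
        ∑ k ∈ Finset.range (n + 1), ∑ f : Fin k → τ.Node, (∏ i, x (f i)) • d k f := by
    simp only [quadrature, Finset.smul_sum]
    rw [Finset.sum_comm]
    refine Finset.sum_congr rfl fun k _ => ?_
    rw [Finset.sum_comm]
    refine Finset.sum_congr rfl fun f _ => ?_
    simp only [smul_smul]
    rw [← Finset.sum_smul, ← sum_treeWeight_mul_prod]
    congr 1
    exact Finset.sum_congr rfl fun φ _ => congrArg _
      (prod_eq_prod_pow_occurrences f fun v => m.c (φ v)).symm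
  rw [h1, quadrature, quadrature, ← Finset.sum_sub_distrib]
  refine (norm_sum_le_of_le _ (n := fun φ => |treeWeight m.tab τ m.b φ| * ε)
    fun φ _ => ?_).trans ?_
  · rw [← smul_sub, norm_smul, Real.norm_eq_abs]
    by_cases h0 : treeWeight m.tab τ m.b φ = 0
    · simp [h0]
    · exact mul_le_mul_of_nonneg_left (hd _ (hD φ h0)) (abs_nonneg _)
  · rw [← Finset.sum_mul]
    exact mul_le_mul_of_nonneg_right (sum_abs_treeWeight_le hK ha τ hb) hε

theorem sum_abs_eulerRow_le {N i : ℕ} (hi : i ≤ N) : ∑ j, |eulerRow N i j| ≤ 1 := by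
  simp only [abs_of_nonneg (eulerRow_nonneg N i _)]
  exact sum_eulerRow_le hi

/-- The quadratures of a method satisfying the order conditions agree with the limit of the
quadratures of composite Euler steps, up to the error of polynomial approximation. -/
theorem exists_norm_quadrature_sub_le {s : ℕ} {m : RKMethod s} {p : ℕ} (hp : m.HasOrder p) {K : ℝ}
    (hK : 1 ≤ K) (ha : ∀ i, ∑ j, |m.tab i j| ≤ K) (hb : ∑ j, |m.b j| ≤ K) {τ : RTree}
    (hτ : τ.order ≤ p) {ε : ℝ} {F : (τ.Node → ℝ) → X} {D : Set (τ.Node → ℝ)} (hε : 0 ≤ ε)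
    (hD : ∀ φ : τ.Node → Fin s, treeWeight m.tab τ m.b φ ≠ 0 → (fun v => m.c (φ v)) ∈ D)
    (hDE : ∀ (N : ℕ) (φ : τ.Node → Fin N), treeWeight (eulerMethod N).tab τ (eulerMethod N).b φ ≠ 0 →
      (fun v => (eulerMethod N).c (φ v)) ∈ D)
    (hF : PolyApprox (p - τ.order) ε F D) :
    ∃ e : ℕ → ℝ, Tendsto e atTop (𝓝 0) ∧ ∀ N,
      ‖quadrature m τ F - quadrature (eulerMethod N) τ F‖ ≤ (K ^ τ.order + 1) * ε + e N := by
  obtain ⟨d, hd⟩ := hF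
  -- `y` stands for the simplex integral of the approximating polynomial. The order conditions make
  -- the method exact on it, while the Euler quadratures `z N` only converge to it; their defect is
  -- `e N`.
  set y : X := ∑ k ∈ Finset.range (p - τ.order + 1), ∑ f : Fin k → τ.Node,
    simplexMoment τ (occurrences f) • d k f
  set z : ℕ → X := fun N => ∑ k ∈ Finset.range (p - τ.order + 1), ∑ f : Fin k → τ.Node,
    moment (eulerMethod N).tab (eulerMethod N).c τ (occurrences f) (eulerMethod N).b • d k f
  have hz : Tendsto z atTop (𝓝 y) := tendsto_finsetSum _ fun k _ => tendsto_finsetSum _ fun f _ =>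
    (tendsto_moment_eulerMethod τ _).smul_const _
  have h1 : ‖quadrature m τ F - y‖ ≤ K ^ τ.order * ε := by
    refine le_trans (le_of_eq ?_) (norm_quadrature_sub_le m hK ha hb τ hε hD hd)
    congr 2
    refine Finset.sum_congr rfl fun k hk => Finset.sum_congr rfl fun f _ => ?_
    rw [hp.moment_eq]
    rw [weight_eq, sum_occurrences]
    have := Finset.mem_range.1 hk
    omega
  have h2 : ∀ N, ‖quadrature (eulerMethod N) τ F - z N‖ ≤ ε := by
    intro N
    have := norm_quadrature_sub_le (eulerMethod N) le_rfl (fun i => sum_abs_eulerRow_le i.2.le)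
      (by rw [eulerMethod_b]; exact sum_abs_eulerRow_le le_rfl) τ hε (hDE N) hd
    rwa [one_pow, one_mul] at this
  refine ⟨fun N => ‖z N - y‖, tendsto_iff_norm_sub_tendsto_zero.1 hz, fun N => ?_⟩
  have e1 : quadrature m τ F - quadrature (eulerMethod N) τ F =
      (quadrature m τ F - y) - (quadrature (eulerMethod N) τ F - z N) - (z N - y) := by abel
  rw [e1]
  refine (norm_sub_le _ _).trans (add_le_add_left ((norm_sub_le _ _).trans ?_) _)
  rw [add_mul, one_mul]
  exact add_le_add h1 (h2 N)

end RTree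

/-! ### The domains of integration -/

namespace RTree

theorem convex_cube (τ : RTree) : Convex ℝ τ.cube := convex_Icc 0 1

theorem zero_mem_cube (τ : RTree) : (0 : τ.Node → ℝ) ∈ τ.cube :=
  left_mem_Icc.2 fun _ => zero_le_one

theorem uniqueDiffOn_cube (τ : RTree) : UniqueDiffOn ℝ τ.cube := by
  rw [cube, ← pi_univ_Icc]
  exact UniqueDiffOn.univ_pi fun _ => uniqueDiffOn_Icc zero_lt_one

theorem norm_le_of_mem_cube {τ : RTree} {σ : τ.Node → ℝ} (h : σ ∈ τ.cube) : ‖σ‖ ≤ 1 := by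
  refine (pi_norm_le_iff_of_nonneg zero_le_one).2 fun v => ?_
  rw [Real.norm_of_nonneg (h.1 v)]
  exact h.2 v

theorem mem_Icc_of_mem_simplex : ∀ {τ : RTree} {ζ : ℝ} {σ : τ.Node → ℝ}, σ ∈ τ.simplex ζ →
    ∀ v, σ v ∈ Icc 0 ζ
  | node _ _, _, _, h, none => h.1
  | node _ _, _, _, h, some ⟨l, v⟩ =>
    Icc_subset_Icc_right h.1.2 (mem_Icc_of_mem_simplex (h.2 l) v)

theorem simplex_subset_cube (τ : RTree) : τ.simplex 1 ⊆ τ.cube := fun _ h =>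
  ⟨fun v => (mem_Icc_of_mem_simplex h v).1, fun v => (mem_Icc_of_mem_simplex h v).2⟩

theorem zero_mem_simplex : ∀ (τ : RTree) {ζ : ℝ}, 0 ≤ ζ → (0 : τ.Node → ℝ) ∈ τ.simplex ζ
  | node _ τ, _, h => ⟨left_mem_Icc.2 h, fun l => zero_mem_simplex (τ l) le_rfl⟩

theorem add_smul_mem_simplex {a b : ℝ} (ha : 0 ≤ a) (hb : 0 ≤ b) :
    ∀ (τ : RTree) {ζ ζ' : ℝ} {σ σ' : τ.Node → ℝ}, σ ∈ τ.simplex ζ → σ' ∈ τ.simplex ζ' →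
      a • σ + b • σ' ∈ τ.simplex (a * ζ + b * ζ')
  | node _ τ, _, _, _, _, h, h' =>
    ⟨⟨add_nonneg (mul_nonneg ha h.1.1) (mul_nonneg hb h'.1.1),
      add_le_add (mul_le_mul_of_nonneg_left h.1.2 ha) (mul_le_mul_of_nonneg_left h'.1.2 hb)⟩,
      fun l => add_smul_mem_simplex ha hb (τ l) (h.2 l) (h'.2 l)⟩

theorem convex_simplex (τ : RTree) (ζ : ℝ) : Convex ℝ (τ.simplex ζ) := by
  intro σ h σ' h' a b ha hb hab
  have := add_smul_mem_simplex ha hb τ h h'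
  rwa [← add_mul, hab, one_mul] at this

/-- An interior point is obtained by halving the variable at each generation. The bound `ζ` varies
along with the point, since for a branch it is the root variable. -/
theorem exists_eventually_mem_simplex : ∀ (τ : RTree) {ζ : ℝ}, 0 < ζ → ∃ σ : τ.Node → ℝ,
    ∀ᶠ x : (τ.Node → ℝ) × ℝ in 𝓝 (σ, ζ), x.1 ∈ τ.simplex x.2
  | node k τ, ζ, hζ => by
    choose σ hσ using fun l => exists_eventually_mem_simplex (τ l) (half_pos hζ)
    refine ⟨(labelEquiv τ).symm (ζ / 2, σ), ?_⟩
    have hroot : Continuous fun x : ((node k τ).Node → ℝ) × ℝ => rootVar x.1 :=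
      (continuous_apply _).comp continuous_fst
    have h1 : ∀ᶠ x : ((node k τ).Node → ℝ) × ℝ in 𝓝 ((labelEquiv τ).symm (ζ / 2, σ), ζ),
        0 < rootVar x.1 :=
      hroot.continuousAt.eventually_const_lt (half_pos hζ)
    have h2 : ∀ᶠ x : ((node k τ).Node → ℝ) × ℝ in 𝓝 ((labelEquiv τ).symm (ζ / 2, σ), ζ),
        rootVar x.1 < x.2 :=
      hroot.continuousAt.eventually_lt continuous_snd.continuousAt (half_lt_self hζ)
    have h3 : ∀ᶠ x : ((node k τ).Node → ℝ) × ℝ in 𝓝 ((labelEquiv τ).symm (ζ / 2, σ), ζ),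
        ∀ l, subVars x.1 l ∈ (τ l).simplex (rootVar x.1) := by
      refine eventually_all.2 fun l => ?_
      have hc : Continuous fun x : ((node k τ).Node → ℝ) × ℝ => (subVars x.1 l, rootVar x.1) :=
        (continuous_pi fun v => (continuous_apply _).comp continuous_fst).prodMk hroot
      exact (hc.tendsto ((labelEquiv τ).symm (ζ / 2, σ), ζ)).eventually (hσ l)
    filter_upwards [h1, h2, h3] with x hx1 hx2 hx3
    exact ⟨⟨hx1.le, hx2.le⟩, hx3⟩

theorem uniqueDiffOn_simplex (τ : RTree) : UniqueDiffOn ℝ (τ.simplex 1) := by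
  refine uniqueDiffOn_convex (convex_simplex τ 1) ?_
  obtain ⟨σ, hσ⟩ := exists_eventually_mem_simplex τ zero_lt_one
  refine ⟨σ, mem_interior_iff_mem_nhds.2 ?_⟩
  have hc : Continuous fun x : τ.Node → ℝ => (x, (1 : ℝ)) := by fun_prop
  exact hc.continuousAt.eventually hσ

variable {ι : Type*}

/-- A nonzero weight means a nonzero coefficient on every edge, and hence nodes that decrease weakly
from parent to child. -/
theorem mem_simplex_of_treeWeight_ne_zero {a : ι → ι → ℝ} {c : ι → ℝ} (hc : ∀ i, 0 ≤ c i)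
    (ha : ∀ i j, a i j ≠ 0 → c j ≤ c i) : ∀ (τ : RTree) {β : ι → ℝ} {ζ : ℝ},
      (∀ j, β j ≠ 0 → c j ≤ ζ) → ∀ φ : τ.Node → ι, treeWeight a τ β φ ≠ 0 →
        (fun v => c (φ v)) ∈ τ.simplex ζ
  | node k τ, β, ζ, hβ, φ, h => by
    rw [treeWeight] at h
    refine ⟨⟨hc _, hβ _ (left_ne_zero_of_mul h)⟩, fun l => ?_⟩
    exact mem_simplex_of_treeWeight_ne_zero hc ha (τ l) (ha _) (branch φ l)
      (Finset.prod_ne_zero_iff.1 (right_ne_zero_of_mul h) l (Finset.mem_univ l))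

theorem mem_simplex_of_monotone {s : ℕ} {m : RKMethod s} (hm : Monotone m.c)
    (hc : ∀ i, m.c i ∈ Icc (0 : ℝ) 1) (τ : RTree) (φ : τ.Node → Fin s)
    (h : treeWeight m.tab τ m.b φ ≠ 0) : (fun v => m.c (φ v)) ∈ τ.simplex 1 :=
  mem_simplex_of_treeWeight_ne_zero (fun i => (hc i).1)
    (fun i j hij => hm (le_of_lt (by by_contra hlt; exact hij (m.tab_eq_zero hlt)))) τ
    (fun j _ => (hc j).2) φ h

theorem monotone_eulerMethod_c (N : ℕ) : Monotone (eulerMethod N).c := fun i j hij => by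
  simp only [eulerMethod]
  exact div_le_div_of_nonneg_right (by exact_mod_cast hij) (by positivity)

/-! ### Rescaling of the integrands -/

variable {X : Type*} [NormedAddCommGroup X] [NormedSpace ℝ X]

/-- The integrand depends on `ζ` and `σ` only through the physical times `ζ * h` and `σ * h`. -/
theorem integrand_scale (S : ℝ → X →L[ℝ] X) (g : X → X) {h H : ℝ} (hH : H ≠ 0) (w : X) :
    ∀ (τ : RTree) (ζ : ℝ) (σ : τ.Node → ℝ),
      integrand S g h w τ ζ σ = integrand S g H w τ (h / H * ζ) ((h / H) • σ)
  | node k τ, ζ, σ => by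
    have e1 : rootVar ((h / H) • σ) = h / H * rootVar σ := rfl
    have e2 : ∀ l, subVars ((h / H) • σ) l = (h / H) • subVars σ l := fun l => rfl
    have e3 : (h / H * ζ - h / H * rootVar σ) * H = (ζ - rootVar σ) * h := by field_simp
    have e4 : h / H * rootVar σ * H = rootVar σ * h := by field_simp
    simp only [integrand, e1, e2, e3, e4, integrand_scale S g hH w (τ _) (rootVar σ)]

theorem integrand_eq_apply {S : ℝ → X →L[ℝ] X} (hS : IsC0Group S) (g : X → X) (h : ℝ) (w : X)
    (τ : RTree) (ζ ζ' : ℝ) (σ : τ.Node → ℝ) :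
    integrand S g h w τ ζ σ = S ((ζ - ζ') * h) (integrand S g h w τ ζ' σ) := by
  cases τ
  simp only [integrand]
  rw [← ContinuousLinearMap.comp_apply, ← hS.add]
  congr 2
  ring

/-- Polynomial approximation of the integrands in the group case. -/
theorem polyApprox_integrand_of_group {S : ℝ → X →L[ℝ] X} (hS : IsC0Group S) {CE : ℝ}
    (hCE : ∀ t, ‖S t‖ ≤ CE) {g : X → X} {w : X} {τ : RTree} {n : ℕ} {M h H : ℝ} (hM : 0 ≤ M)
    (hh : 0 < h) (hhH : h ≤ H) (hF : IsCkLip n M (τ.integrand S g H w 1) τ.cube) :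
    PolyApprox n (CE * (M * (h / H) ^ (n + 1))) (τ.integrand S g h w 1) τ.cube := by
  have hH : 0 < H := hh.trans_le hhH
  have hr : h / H ∈ Icc (0 : ℝ) 1 := ⟨by positivity, div_le_one_of_le₀ hhH hH.le⟩
  have hsub : (fun σ : τ.Node → ℝ => (h / H) • σ) '' τ.cube ⊆ τ.cube := by
    rintro _ ⟨σ, hσ, rfl⟩
    exact (convex_cube τ).smul_mem_of_zero_mem (zero_mem_cube τ) hσ hr
  obtain ⟨d, hd⟩ := hF.polyApprox hM (convex_cube τ) (uniqueDiffOn_cube τ) (zero_mem_cube τ)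
    (ε := M * (h / H) ^ (n + 1)) hsub (by
      rintro _ ⟨σ, hσ, rfl⟩
      simp only
      rw [norm_smul, Real.norm_of_nonneg hr.1]
      gcongr
      exact mul_le_of_le_one_right hr.1 (norm_le_of_mem_cube hσ))
  -- Rescaling to step `H` changes the end time from `1` to `h / H`. The operator `S ((h / H - 1) *
  -- H)`, in general at a negative time, corrects this; here the group is indispensable.
  refine ⟨fun k f => (h / H) ^ k • S ((h / H - 1) * H) (d k f), fun σ hσ => ?_⟩
  have e : τ.integrand S g h w 1 σ - ∑ k ∈ Finset.range (n + 1), ∑ f : Fin k → τ.Node,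
      (∏ i, σ (f i)) • (h / H) ^ k • S ((h / H - 1) * H) (d k f) =
      S ((h / H - 1) * H) (τ.integrand S g H w 1 ((h / H) • σ) -
        ∑ k ∈ Finset.range (n + 1), ∑ f : Fin k → τ.Node,
          (∏ i, ((h / H) • σ) (f i)) • d k f) := by
    rw [integrand_scale S g hH.ne', integrand_eq_apply hS g H w τ _ 1, mul_one]
    simp only [map_sub, map_sum, map_smul, Pi.smul_apply, smul_eq_mul, Finset.prod_mul_distrib,
      Finset.prod_const, Finset.card_fin, smul_smul]
    simp only [mul_comm]
  rw [e]
  exact (ContinuousLinearMap.le_opNorm _ _).trans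
    (mul_le_mul (hCE _) (hd _ ⟨σ, hσ, rfl⟩) (norm_nonneg _) ((norm_nonneg _).trans (hCE 0)))

theorem polyApprox_integrand_of_simplex {S : ℝ → X →L[ℝ] X} {g : X → X} {w : X} {τ : RTree}
    {n : ℕ} {L h : ℝ} (hL : 0 ≤ L) (hF : IsCkLip n L (τ.integrand S g h w 1) (τ.simplex 1)) :
    PolyApprox n L (τ.integrand S g h w 1) (τ.simplex 1) :=
  hF.polyApprox hL (convex_simplex τ 1) (uniqueDiffOn_simplex τ) (zero_mem_simplex τ zero_le_one)
    subset_rfl fun _ hσ => mul_le_of_le_one_right hL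
      (pow_le_one₀ (norm_nonneg _) (norm_le_of_mem_cube (simplex_subset_cube τ hσ)))

end RTree

/-! ### Mild solutions and their approximation by exponential Euler steps -/

variable {X : Type*} [NormedAddCommGroup X] [NormedSpace ℝ X]

theorem IsC0Group.isC0Semigroup {S : ℝ → X →L[ℝ] X} (hS : IsC0Group S) : IsC0Semigroup S :=
  ⟨hS.zero, fun t₁ t₂ _ _ => hS.add t₁ t₂, fun x => (hS.continuous x).continuousOn⟩

variable {S : ℝ → X →L[ℝ] X} {g : X → X} {T : ℝ} {u : ℝ → X} {CE B r : ℝ}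

theorem IsMildSolution.intervalIntegrable (hu : IsMildSolution S g T u) {t a b : ℝ}
    (ht : t ∈ Icc 0 T) (ha : a ∈ Icc 0 t) (hb : b ∈ Icc 0 t) :
    IntervalIntegrable (fun r => S (t - r) (g (u r))) volume a b :=
  (hu.integrable t ht).mono_set (uIcc_subset_uIcc
    (by rwa [uIcc_of_le ht.1]) (by rwa [uIcc_of_le ht.1]))

/-- The semigroup law pulls `S x` through the integral over the past, so variation of constants
holds from any starting time. -/
theorem IsMildSolution.restart [CompleteSpace X] (hS : IsC0Semigroup S)
    (hu : IsMildSolution S g T u) {t x : ℝ} (ht : 0 ≤ t) (hx : 0 ≤ x) (htx : t + x ≤ T) :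
    u (t + x) = S x (u t) + ∫ r in t..(t + x), S (t + x - r) (g (u r)) := by
  have htT : t ∈ Icc 0 T := ⟨ht, by linarith⟩
  have htxT : t + x ∈ Icc 0 T := ⟨by linarith, htx⟩
  have h1 : ∫ r in (0 : ℝ)..t, S (t + x - r) (g (u r)) =
      S x (∫ r in (0 : ℝ)..t, S (t - r) (g (u r))) := by
    rw [← ContinuousLinearMap.intervalIntegral_comp_comm _ (hu.integrable t htT)]
    refine intervalIntegral.integral_congr fun r hr => ?_
    rw [uIcc_of_le ht] at hr
    rw [← ContinuousLinearMap.comp_apply, ← hS.add x (t - r) hx (sub_nonneg.2 hr.2)]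
    congr 2
    ring
  rw [hu.duhamel _ htxT, hu.duhamel _ htT, map_add, ← h1, add_assoc,
    intervalIntegral.integral_add_adjacent_intervals
      (hu.intervalIntegrable htxT ⟨le_rfl, htxT.1⟩ ⟨ht, by linarith⟩)
      (hu.intervalIntegrable htxT ⟨ht, by linarith⟩ ⟨htxT.1, le_rfl⟩),
    ← ContinuousLinearMap.comp_apply, ← hS.add x t hx ht, add_comm x t]

theorem IsMildSolution.norm_sub_le [CompleteSpace X] (hS : IsC0Semigroup S)
    (hCE : ∀ t, 0 ≤ t → ‖S t‖ ≤ CE) (hu : IsMildSolution S g T u)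
    (hB : ∀ t ∈ Icc 0 T, ‖g (u t)‖ ≤ B) {t x : ℝ} (ht : 0 ≤ t) (hx : 0 ≤ x) (htx : t + x ≤ T) :
    ‖u (t + x) - S x (u t)‖ ≤ CE * B * x := by
  rw [hu.restart hS ht hx htx, add_sub_cancel_left]
  refine (intervalIntegral.norm_integral_le_of_norm_le_const fun r hr => ?_).trans
    (le_of_eq (?_ : CE * B * |t + x - t| = _))
  · rw [uIoc_of_le (by linarith)] at hr
    exact ContinuousLinearMap.le_of_opNorm_le_of_le _ (hCE _ (by linarith [hr.2]))
      (hB r ⟨by linarith [hr.1], by linarith [hr.2]⟩)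
  · rw [add_sub_cancel_left, abs_of_nonneg hx]

/-- Strong continuity together with the uniform Lipschitz bound in the vector gives joint
continuity. -/
theorem IsC0Semigroup.continuousOn_apply (hS : IsC0Semigroup S) (hCE : ∀ t, 0 ≤ t → ‖S t‖ ≤ CE)
    {G : ℝ → X} {I : Set ℝ} (hG : ContinuousOn G I) :
    ContinuousOn (fun x : ℝ × ℝ => S x.1 (G x.2)) (Ici 0 ×ˢ I) := by
  have h1 : ContinuousOn (fun y : X × ℝ => S y.2 y.1) (univ ×ˢ Ici 0) := by
    refine continuousOn_prod_of_continuousOn_lipschitzOnWith _ (Real.toNNReal CE)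
      (fun x _ => hS.continuousOn x) fun t ht => ?_
    refine ((S t).lipschitz.weaken ?_).lipschitzOnWith
    rw [← norm_toNNReal]
    exact Real.toNNReal_le_toNNReal (hCE t ht)
  exact h1.comp (f := fun x : ℝ × ℝ => (G x.2, x.1))
    ((hG.comp continuousOn_snd fun x hx => hx.2).prodMk continuousOn_fst)
    fun x hx => ⟨mem_univ _, hx.1⟩

/-- Uniform continuity on a compact square compares `G s` with `S (s - a) (G a)`; applying the
bounded operator `S (b - s)` transports this to time `b`. -/
theorem IsC0Semigroup.exists_modulus (hS : IsC0Semigroup S) (hCE : ∀ t, 0 ≤ t → ‖S t‖ ≤ CE)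
    {G : ℝ → X} (hG : ContinuousOn G (Icc 0 T)) {ε : ℝ} (hε : 0 < ε) :
    ∃ η > 0, ∀ a b s, 0 ≤ a → a ≤ s → s ≤ a + η → s ≤ b → b ≤ T →
      ‖S (b - s) (G s) - S (b - a) (G a)‖ ≤ ε := by
  have huc : UniformContinuousOn (fun x : ℝ × ℝ => S x.1 (G x.2)) (Icc 0 T ×ˢ Icc 0 T) :=
    (isCompact_Icc.prod isCompact_Icc).uniformContinuousOn_of_continuous
      ((hS.continuousOn_apply hCE hG).mono (prod_mono_left Icc_subset_Ici_self))
  have hCE0 : 0 ≤ CE := (norm_nonneg _).trans (hCE 0 le_rfl)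
  obtain ⟨η, hη, h⟩ := Metric.uniformContinuousOn_iff.1 huc (ε / (CE + 1)) (by positivity)
  refine ⟨η / 2, by positivity, fun a b s ha has hs hsb hb => ?_⟩
  have h1 := h (0, s) ⟨⟨le_rfl, by linarith⟩, ⟨by linarith, by linarith⟩⟩ (s - a, a)
    ⟨⟨by simp only; linarith, by simp only; linarith⟩, ⟨ha, by simp only; linarith⟩⟩ (by
      rw [Prod.dist_eq]
      refine max_lt ?_ ?_ <;> simp only [Real.dist_eq]
      · rw [zero_sub, abs_neg, abs_of_nonneg (by linarith)]
        linarith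
      · rw [abs_of_nonneg (by linarith)]
        linarith)
  simp only [dist_eq_norm, hS.zero, ContinuousLinearMap.id_apply] at h1
  have h2 : S (b - a) (G a) = S (b - s) (S (s - a) (G a)) := by
    rw [← ContinuousLinearMap.comp_apply, ← hS.add _ _ (by linarith) (by linarith)]
    congr 2
    ring
  rw [h2, ← map_sub]
  refine ((S (b - s)).le_of_opNorm_le_of_le (hCE _ (by linarith)) h1.le).trans ?_
  rw [mul_div_assoc', div_le_iff₀ (by positivity)]
  nlinarith

/-- The Lawson scheme based on `N` Euler steps converges to the mild solution. -/
theorem IsMildSolution.tendsto_euler [CompleteSpace X] (hS : IsC0Semigroup S)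
    (hCE : ∀ t, 0 ≤ t → ‖S t‖ ≤ CE) (hu : IsMildSolution S g T u) (hr : 0 < r)
    (hlip : ∀ t ∈ Icc 0 T, ∀ y, ‖y - u t‖ < r → ‖g y - g (u t)‖ ≤ B * ‖y - u t‖)
    (hB : 0 ≤ B) {t h : ℝ} (ht : 0 ≤ t) (hh : 0 < h) (hth : t + h ≤ T)
    (hsmall : h * (CE * B) ≤ 1 / 2) :
    Tendsto (fun N => (eulerMethod N).lawsonStep S g h (u t)) atTop (𝓝 (u (t + h))) := by
  have hCE0 : 0 ≤ CE := (norm_nonneg _).trans (hCE 0 le_rfl)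
  have hG : ContinuousOn (fun s => g (u s)) (Icc 0 T) := by
    intro s hs
    have hus : Tendsto (fun y => ‖u y - u s‖) (𝓝[Icc 0 T] s) (𝓝 0) :=
      tendsto_iff_norm_sub_tendsto_zero.1 (hu.continuousOn s hs)
    refine tendsto_iff_norm_sub_tendsto_zero.2 (squeeze_zero' (.of_forall fun _ => norm_nonneg _)
      ?_ (by simpa using hus.const_mul B))
    filter_upwards [hus.eventually_lt_const hr] with y hy using hlip s hs _ hy
  rw [Metric.tendsto_atTop]
  intro ε' hε'
  -- The target error is `2 * ε`: the quadrature contributes `ε`, and earlier errors contribute `h *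
  -- (CE * B) * (2 * ε) ≤ ε`, so no Gronwall argument is needed. The condition `2 * ε < r` keeps the
  -- stages where the Lipschitz bound applies.
  obtain ⟨ε, hε, hεr, hεε'⟩ : ∃ ε > 0, 2 * ε < r ∧ 2 * ε < ε' :=
    ⟨min r ε' / 4, by positivity, by linarith [min_le_left r ε', lt_min hr hε'],
      by linarith [min_le_right r ε', lt_min hr hε']⟩
  obtain ⟨η, hη, hmod⟩ := hS.exists_modulus hCE hG (div_pos hε hh)
  obtain ⟨N₀, hN₀⟩ := exists_nat_gt (h / η)
  refine ⟨N₀ + 1, fun N hN => ?_⟩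
  have hNpos : (0 : ℝ) < N := by exact_mod_cast (by omega : 0 < N)
  have hstep : h / N ≤ η := by
    rw [div_le_iff₀ hNpos]
    rw [div_lt_iff₀ hη] at hN₀
    have : (N₀ : ℝ) ≤ N := by exact_mod_cast (by omega : N₀ ≤ N)
    nlinarith
  set m := eulerMethod N
  set V : ℕ → X := fun j => if hj : j < N then m.lawsonStage S g h (u t) ⟨j, hj⟩ else 0
  have hV : ∀ j : Fin N, m.lawsonStage S g h (u t) j = V j := fun j => by simp [V]
  -- The approximation at time `t + i / N * h`: a stage for `i < N`, the step itself for `i = N`.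
  set Y : ℕ → X := fun i => S (i / N * h) (u t) +
    h • ∑ j ∈ Finset.range i, (1 / N : ℝ) • S ((i / N - j / N) * h) (g (V j))
  have hVY : ∀ j, j < N → V j = Y j := by
    intro j hj
    have h1 : V j = m.lawsonStage S g h (u t) ⟨j, hj⟩ := (hV ⟨j, hj⟩).symm
    rw [h1, m.lawsonStage_eq]
    simp only [hV]
    exact congrArg (fun z => S (j / N * h) (u t) + h • z)
      (sum_eulerRow_mul hj.le fun l => S ((j / N - l / N) * h) (g (V l)))
  have hYN : m.lawsonStep S g h (u t) = Y N := by
    have h1 := sum_eulerRow_mul (N := N) le_rfl fun l => S ((1 - l / N) * h) (g (V l))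
    rw [← eulerMethod_b] at h1
    simp only [RKMethod.lawsonStep, hV, Y, div_self hNpos.ne', one_mul]
    exact congrArg (fun z => S h (u t) + h • z) h1
  have htime : ∀ i ≤ N, (i : ℝ) / N * h ≤ h := fun i hi =>
    mul_le_of_le_one_left hh.le (div_le_one_of_le₀ (by exact_mod_cast hi) hNpos.le)
  have htime0 : ∀ i : ℕ, 0 ≤ (i : ℝ) / N * h := fun i => by positivity
  have hmem : ∀ i ≤ N, t + (i : ℝ) / N * h ∈ Icc 0 T := fun i hi =>
    ⟨by linarith [htime0 i], by linarith [htime i hi]⟩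
  have hmain : ∀ i ≤ N, ‖Y i - u (t + i / N * h)‖ ≤ 2 * ε := by
    intro i
    induction i using Nat.strong_induction_on with
    | _ i ih =>
      intro hi
      set b : ℝ := t + i / N * h
      set a : ℕ → ℝ := fun j => t + j / N * h
      have ha_mono : ∀ j k : ℕ, j ≤ k → a j ≤ a k := fun j k hjk => by
        simp only [a]; gcongr
      have ha_mem : ∀ j ≤ i, a j ∈ Icc 0 b := fun j hj =>
        ⟨(hmem j (hj.trans hi)).1, ha_mono j i hj⟩
      have hint : ∀ j < i, IntervalIntegrable (fun s => S (b - s) (g (u s))) volume (a j)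
          (a (j + 1)) := fun j hj =>
        hu.intervalIntegrable (hmem i hi) (ha_mem j hj.le) (ha_mem (j + 1) hj)
      have ha0 : a 0 = t := by simp [a]
      have hlen : ∀ j, a (j + 1) - a j = h / N := fun j => by
        simp only [a]; push_cast; ring
      have hlen0 : 0 ≤ h / N := by positivity
      have hsplit : u b = S (i / N * h) (u t) +
          ∑ j ∈ Finset.range i, ∫ s in (a j)..(a (j + 1)), S (b - s) (g (u s)) := by
        rw [intervalIntegral.sum_integral_adjacent_intervals hint, ha0]
        exact hu.restart hS ht (htime0 i) (by linarith [htime i hi])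
      have hpiece : ∀ j ∈ Finset.range i,
          ‖(h / N) • S ((i / N - j / N) * h) (g (V j)) -
            ∫ s in (a j)..(a (j + 1)), S (b - s) (g (u s))‖ ≤
            h / N * (CE * (B * (2 * ε)) + ε / h) := by
        intro j hj
        have hj : j < i := Finset.mem_range.1 hj
        have hjN : j < N := hj.trans_le hi
        have hba : b - a j = (i / N - j / N) * h := by simp only [b, a]; ring
        have hba0 : 0 ≤ b - a j := sub_nonneg.2 (ha_mem j hj.le).2
        have h1 : ‖(h / N) • S (b - a j) (g (V j)) - (h / N) • S (b - a j) (g (u (a j)))‖ ≤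
            h / N * (CE * (B * (2 * ε))) := by
          have hVj : ‖V j - u (a j)‖ ≤ 2 * ε := by rw [hVY j hjN]; exact ih j hj hjN.le
          rw [← smul_sub, ← map_sub, norm_smul, Real.norm_of_nonneg hlen0]
          refine mul_le_mul_of_nonneg_left ?_ hlen0
          exact (S (b - a j)).le_of_opNorm_le_of_le (hCE _ hba0)
            ((hlip _ (hmem j hjN.le) _ (hVj.trans_lt hεr)).trans
              (mul_le_mul_of_nonneg_left hVj hB))
        have h2 : ‖(h / N) • S (b - a j) (g (u (a j))) -
            ∫ s in (a j)..(a (j + 1)), S (b - s) (g (u s))‖ ≤ h / N * (ε / h) := by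
          have e : (h / N) • S (b - a j) (g (u (a j))) =
              ∫ s in (a j)..(a (j + 1)), S (b - a j) (g (u (a j))) := by
            rw [intervalIntegral.integral_const, hlen]
          rw [e, ← intervalIntegral.integral_sub intervalIntegrable_const (hint j hj)]
          refine (intervalIntegral.norm_integral_le_of_norm_le_const (C := ε / h)
            fun s hs => ?_).trans (le_of_eq ?_)
          · rw [uIoc_of_le (ha_mono j _ (Nat.le_succ j))] at hs
            rw [norm_sub_rev]
            refine hmod (a j) b s (hmem j hjN.le).1 hs.1.le ?_ (hs.2.trans (ha_mem _ hj).2)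
              (hmem i hi).2
            linarith [hs.2, hlen j]
          · rw [hlen, abs_of_nonneg hlen0, mul_comm]
        rw [← hba, mul_add]
        exact (norm_sub_le_norm_sub_add_norm_sub _ _ _).trans (add_le_add h1 h2)
      have hdiff : Y i - u b = ∑ j ∈ Finset.range i,
          ((h / N) • S ((i / N - j / N) * h) (g (V j)) -
            ∫ s in (a j)..(a (j + 1)), S (b - s) (g (u s))) := by
        rw [hsplit, Finset.sum_sub_distrib]
        simp only [Y, Finset.smul_sum, smul_smul, mul_one_div]
        abel
      rw [hdiff]
      refine (norm_sum_le_of_le _ hpiece).trans ?_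
      rw [Finset.sum_const, Finset.card_range, nsmul_eq_mul]
      have h3 : (i : ℝ) * (h / N * (CE * (B * (2 * ε)) + ε / h)) ≤
          h * (CE * (B * (2 * ε)) + ε / h) := by
        have := mul_le_mul_of_nonneg_right (htime i hi)
          (by positivity : 0 ≤ CE * (B * (2 * ε)) + ε / h)
        linarith [this, (by ring : (i : ℝ) * (h / N * (CE * (B * (2 * ε)) + ε / h)) =
          i / N * h * (CE * (B * (2 * ε)) + ε / h))]
      have h4 : h * (CE * (B * (2 * ε)) + ε / h) = h * (CE * B) * (2 * ε) + ε := by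
        field_simp
      have h5 := mul_le_mul_of_nonneg_right hsmall (by positivity : 0 ≤ 2 * ε)
      linarith
  have := hmain N le_rfl
  rw [div_self hNpos.ne', one_mul, ← hYN] at this
  rw [dist_eq_norm]
  exact this.trans_lt hεε'

/-! ### The local error of Lawson methods -/

section LocalError

variable {X : Type*} [NormedAddCommGroup X] [NormedSpace ℝ X]
  {S : ℝ → X →L[ℝ] X} {g : X → X} {w : X} {h r CE B K : ℝ} {p s : ℕ} {U : Set X}

/-- The operator coefficients of the stages of the Lawson method. -/
def lawsonTab (m : RKMethod s) (S : ℝ → X →L[ℝ] X) (h : ℝ) (i j : Fin s) : X →L[ℝ] X :=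
  m.tab i j • S ((m.c i - m.c j) * h)

/-- The operator coefficients of the step of the Lawson method. -/
def lawsonWeight (m : RKMethod s) (S : ℝ → X →L[ℝ] X) (h : ℝ) (j : Fin s) : X →L[ℝ] X :=
  m.b j • S ((1 - m.c j) * h)

/-- The derivatives of the nonlinearity at the stages of the linear flow. -/
def stageDeriv (m : RKMethod s) (S : ℝ → X →L[ℝ] X) (g : X → X) (h : ℝ) (w : X) (k : ℕ)
    (j : Fin s) : X [×k]→L[ℝ] X :=
  iteratedFDeriv ℝ k g (S (m.c j * h) w)

/-- The data of one step of a Lawson method that enter the error bounds. -/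
structure StepBounds (m : RKMethod s) (S : ℝ → X →L[ℝ] X) (h : ℝ) (w : X) (U : Set X)
    (CE K r : ℝ) : Prop where
  sum_tab : ∀ i, ∑ j, |m.tab i j| ≤ K
  sum_b : ∑ j, |m.b j| ≤ K
  norm_stage : ∀ i j, j < i → ‖S ((m.c i - m.c j) * h)‖ ≤ CE
  norm_step : ∀ j, ‖S ((1 - m.c j) * h)‖ ≤ CE
  mem : ∀ j, ∀ z, ‖z - S (m.c j * h) w‖ < r → z ∈ U

variable {m : RKMethod s}

theorem StepBounds.sum_norm_lawsonTab (hm : StepBounds m S h w U CE K r) (hCE : 0 ≤ CE)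
    (i : Fin s) : ∑ j, ‖lawsonTab m S h i j‖ ≤ K * CE := by
  refine (Finset.sum_le_sum fun j _ => ?_).trans
    ((Finset.sum_mul _ _ _).symm.trans_le (mul_le_mul_of_nonneg_right (hm.sum_tab i) hCE))
  rw [lawsonTab, norm_smul, Real.norm_eq_abs]
  by_cases hj : j < i
  · exact mul_le_mul_of_nonneg_left (hm.norm_stage i j hj) (abs_nonneg _)
  · simp [m.tab_eq_zero hj]

theorem StepBounds.sum_norm_lawsonWeight (hm : StepBounds m S h w U CE K r) (hCE : 0 ≤ CE) :
    ∑ j, ‖lawsonWeight m S h j‖ ≤ K * CE := by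
  refine (Finset.sum_le_sum fun j _ => ?_).trans
    ((Finset.sum_mul _ _ _).symm.trans_le (mul_le_mul_of_nonneg_right hm.sum_b hCE))
  rw [lawsonWeight, norm_smul, Real.norm_eq_abs]
  exact mul_le_mul_of_nonneg_left (hm.norm_step j) (abs_nonneg _)

theorem StepBounds.norm_lawsonStage_sub_lt (hm : StepBounds m S h w U CE K r) (hCE : 0 ≤ CE)
    (hh : 0 ≤ h) (hB : 0 ≤ B) (hg : ∀ z ∈ U, ‖g z‖ ≤ B) (hr : h * (K * CE * B) < r) (i : Fin s) :
    ‖m.lawsonStage S g h w i - S (m.c i * h) w‖ < r := by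
  induction i using WellFoundedLT.induction with
  | ind i ih =>
    rw [m.lawsonStage_eq, add_sub_cancel_left, norm_smul, Real.norm_of_nonneg hh]
    refine lt_of_le_of_lt (mul_le_mul_of_nonneg_left ?_ hh) hr
    refine (norm_sum_le_of_le _ (n := fun j => ‖lawsonTab m S h i j‖ * B) fun j _ => ?_).trans ?_
    · change ‖lawsonTab m S h i j (g (m.lawsonStage S g h w j))‖ ≤ _
      by_cases hj : j < i
      · exact (lawsonTab m S h i j).le_of_opNorm_le_of_le le_rfl (hg _ (hm.mem j _ (ih j hj)))
      · simp [lawsonTab, m.tab_eq_zero hj]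
    · rw [← Finset.sum_mul]
      exact mul_le_mul_of_nonneg_right (hm.sum_norm_lawsonTab hCE i) hB

theorem BoundedDerivs.norm_le (hg : BoundedDerivs p g U B) {z : X} (hz : z ∈ U) : ‖g z‖ ≤ B := by
  simpa using hg.2 0 (Nat.zero_le _) z hz

/-- The abstract expansion, with `g` expanded at `e^{-c_j h A} w`; since the stages stay within `r`
of these points, the connecting segments lie in `U`. -/
theorem StepBounds.norm_lawsonStep_sub_truncSum_le (hm : StepBounds m S h w U CE K r)
    (hCE : 0 ≤ CE) (hK : 0 ≤ K) (hh : 0 ≤ h) (hB : 0 ≤ B) (hU : IsOpen U)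
    (hg : BoundedDerivs p g U B) (hr0 : 0 < r) (hr : h * (K * CE * B) < r)
    (hsmall : h * (K * CE * (B * p)) ≤ 1) (hsmall' : h * (K * CE * B) ≤ 1) :
    ‖m.lawsonStep S g h w - S h w -
      truncSum (lawsonTab m S h) (stageDeriv m S g h w) h p (lawsonWeight m S h)‖ ≤
        truncConst (K * CE) B p * h ^ (p + 1) := by
  have hstage := hm.norm_lawsonStage_sub_lt hCE hh hB (fun z hz => hg.norm_le hz) hr
  rw [RKMethod.lawsonStep, add_sub_cancel_left]
  refine norm_sub_truncSum_le (G := fun j => g (m.lawsonStage S g h w j))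
    (δ := fun j => m.lawsonStage S g h w j - S (m.c j * h) w) hh (mul_nonneg hK hCE) hB
    (hm.sum_norm_lawsonTab hCE) (fun k hk j => hg.2 k hk.le _ (hm.mem j _ (by simpa using hr0)))
    hsmall hsmall' (fun i => ?_) (fun n hn j => ?_) p le_rfl _ (hm.sum_norm_lawsonWeight hCE)
  · rw [m.lawsonStage_eq, add_sub_cancel_left]
    rfl
  · have h1 := norm_sub_taylor_fderiv_le (x := S (m.c j * h) w)
      (δ := m.lawsonStage S g h w j - S (m.c j * h) w) hU (fun k hk => hg.1 k (hk.trans_le hn))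
      (hg.2 n hn) fun t ht => hm.mem j _ (by
        rw [add_sub_cancel_left, norm_smul, Real.norm_of_nonneg ht.1]
        exact (mul_le_of_le_one_left (norm_nonneg _) ht.2).trans_lt (hstage j))
    rw [add_sub_cancel] at h1
    exact h1

theorem elementary_lawson (m : RKMethod s) (S : ℝ → X →L[ℝ] X) (g : X → X) (h : ℝ) (w : X)
    (τ : RTree) : elementary (lawsonTab m S h) (stageDeriv m S g h w) τ (lawsonWeight m S h) =
      τ.quadrature m (τ.integrand S g h w 1) :=
  RTree.elementary_eq_sum m.tab m.c S g h w τ m.b 1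

/-- The constant in the comparison of the elementary quadratures of a single tree. -/
def treeConst (K CE B A : ℝ) (τ : RTree) : ℝ :=
  (K ^ τ.order + 1) * A + 2 * (K * CE * B) ^ τ.order

/-- The constant in the comparison of a Lawson method with composite Euler steps. -/
def compareConst (p : ℕ) (K CE B : ℝ) (A : RTree → ℝ) : ℝ :=
  2 * truncConst (K * CE) B p + ∑ x : TruncTree p,
    |(TruncTree.toTree p x).coeff| *
      treeConst K CE B (A (TruncTree.toTree p x)) (TruncTree.toTree p x)

/-- Trees with at most `p` nodes are compared through polynomial approximation, with `h^ρ h^(p-ρ+1)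
= h^(p+1)`; for larger ones both quadratures are bounded separately. -/
theorem exists_norm_elementary_sub_le (hp : m.HasOrder p) (hm : StepBounds m S h w U CE K r)
    (hE : ∀ N, StepBounds (eulerMethod N) S h w U CE K r) (hCE : 0 ≤ CE) (hK : 1 ≤ K)
    (hh : 0 < h) (hh1 : h ≤ 1) (hB : 0 ≤ B) (hg : BoundedDerivs p g U B) (hr0 : 0 < r)
    {A : RTree → ℝ} (hA : ∀ τ, 0 ≤ A τ)
    (happrox : ∀ τ : RTree, τ.order ≤ p → ∃ D : Set (τ.Node → ℝ),
      (∀ φ : τ.Node → Fin s, τ.treeWeight m.tab m.b φ ≠ 0 → (fun v => m.c (φ v)) ∈ D) ∧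
      (∀ (N : ℕ) (φ : τ.Node → Fin N),
        τ.treeWeight (eulerMethod N).tab (eulerMethod N).b φ ≠ 0 →
          (fun v => (eulerMethod N).c (φ v)) ∈ D) ∧
      PolyApprox (p - τ.order) (A τ * h ^ (p - τ.order + 1)) (τ.integrand S g h w 1) D)
    (x : TruncTree p) : ∃ e : ℕ → ℝ, Tendsto e atTop (𝓝 0) ∧ ∀ N,
      h ^ (TruncTree.toTree p x).order *
        ‖elementary (lawsonTab m S h) (stageDeriv m S g h w) (TruncTree.toTree p x)
            (lawsonWeight m S h) -
          elementary (lawsonTab (eulerMethod N) S h) (stageDeriv (eulerMethod N) S g h w)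
            (TruncTree.toTree p x) (lawsonWeight (eulerMethod N) S h)‖ ≤
        treeConst K CE B (A (TruncTree.toTree p x)) (TruncTree.toTree p x) * h ^ (p + 1) + e N := by
  set τ := TruncTree.toTree p x
  have hK0 : 0 ≤ K := zero_le_one.trans hK
  have hnn : 0 ≤ (K * CE * B) ^ τ.order := by positivity
  have hnn' : 0 ≤ (K ^ τ.order + 1) * A τ := mul_nonneg (by positivity) (hA τ)
  rcases le_or_gt τ.order p with hτ | hτ
  · obtain ⟨D, hD, hDE, hF⟩ := happrox τ hτ
    obtain ⟨e, he, hle⟩ := RTree.exists_norm_quadrature_sub_le hp hK hm.sum_tab hm.sum_b hτ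
      (mul_nonneg (hA τ) (by positivity)) hD hDE hF
    refine ⟨fun N => h ^ τ.order * e N, by simpa using he.const_mul (h ^ τ.order), fun N => ?_⟩
    rw [elementary_lawson, elementary_lawson]
    refine (mul_le_mul_of_nonneg_left (hle N) (by positivity)).trans ?_
    have e1 : h ^ τ.order * h ^ (p - τ.order + 1) = h ^ (p + 1) := by
      rw [← pow_add]
      congr 1
      omega
    rw [mul_add, treeConst, add_mul, ← e1]
    have : 0 ≤ 2 * (K * CE * B) ^ τ.order * (h ^ τ.order * h ^ (p - τ.order + 1)) := by positivity
    linarith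
  · refine ⟨fun _ => 0, tendsto_const_nhds, fun N => ?_⟩
    have hpow : h ^ τ.order ≤ h ^ (p + 1) := pow_le_pow_of_le_one hh.le hh1 hτ
    have hL : ∀ {s' : ℕ} (m' : RKMethod s'), StepBounds m' S h w U CE K r →
        ‖elementary (lawsonTab m' S h) (stageDeriv m' S g h w) τ (lawsonWeight m' S h)‖ ≤
          (K * CE * B) ^ τ.order := fun m' hm' =>
      norm_elementary_le (p := p) (hm'.sum_norm_lawsonTab hCE) hB
        (fun k hk j => hg.2 k hk.le _ (hm'.mem j _ (by simpa using hr0))) (mul_nonneg hK0 hCE)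
        le_rfl p le_rfl x _ (hm'.sum_norm_lawsonWeight hCE)
    have h1 := (norm_sub_le _ _).trans (add_le_add (hL m hm) (hL _ (hE N)))
    refine (mul_le_mul hpow h1 (norm_nonneg _) (by positivity)).trans ?_
    rw [treeConst, add_zero, add_mul]
    have := mul_nonneg hnn' (pow_nonneg hh.le (p + 1))
    linarith

theorem exists_norm_lawsonStep_sub_le (hp : m.HasOrder p) (hm : StepBounds m S h w U CE K r)
    (hE : ∀ N, StepBounds (eulerMethod N) S h w U CE K r) (hCE : 0 ≤ CE) (hK : 1 ≤ K)
    (hh : 0 < h) (hh1 : h ≤ 1) (hB : 0 ≤ B) (hU : IsOpen U) (hg : BoundedDerivs p g U B)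
    (hr0 : 0 < r) (hr : h * (K * CE * B) < r)
    (hsmall : h * (K * CE * (B * p)) ≤ 1) (hsmall' : h * (K * CE * B) ≤ 1)
    {A : RTree → ℝ} (hA : ∀ τ, 0 ≤ A τ)
    (happrox : ∀ τ : RTree, τ.order ≤ p → ∃ D : Set (τ.Node → ℝ),
      (∀ φ : τ.Node → Fin s, τ.treeWeight m.tab m.b φ ≠ 0 → (fun v => m.c (φ v)) ∈ D) ∧
      (∀ (N : ℕ) (φ : τ.Node → Fin N),
        τ.treeWeight (eulerMethod N).tab (eulerMethod N).b φ ≠ 0 →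
          (fun v => (eulerMethod N).c (φ v)) ∈ D) ∧
      PolyApprox (p - τ.order) (A τ * h ^ (p - τ.order + 1)) (τ.integrand S g h w 1) D) :
    ∃ e : ℕ → ℝ, Tendsto e atTop (𝓝 0) ∧ ∀ N,
      ‖m.lawsonStep S g h w - (eulerMethod N).lawsonStep S g h w‖ ≤
        compareConst p K CE B A * h ^ (p + 1) + e N := by
  have hK0 : 0 ≤ K := zero_le_one.trans hK
  choose e he hle using
    exists_norm_elementary_sub_le hp hm hE hCE hK hh hh1 hB hg hr0 hA happrox
  refine ⟨fun N => ∑ x : TruncTree p, |(TruncTree.toTree p x).coeff| * e x N, ?_, fun N => ?_⟩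
  · have := tendsto_finsetSum Finset.univ fun (x : TruncTree p) _ =>
      (he x).const_mul |(TruncTree.toTree p x).coeff|
    simpa using this
  · have h1 := hm.norm_lawsonStep_sub_truncSum_le hCE hK0 hh.le hB hU hg hr0 hr hsmall hsmall'
    have h2 := (hE N).norm_lawsonStep_sub_truncSum_le hCE hK0 hh.le hB hU hg hr0 hr hsmall hsmall'
    have h3 : ‖truncSum (lawsonTab m S h) (stageDeriv m S g h w) h p (lawsonWeight m S h) -
        truncSum (lawsonTab (eulerMethod N) S h) (stageDeriv (eulerMethod N) S g h w) h p
          (lawsonWeight (eulerMethod N) S h)‖ ≤ ∑ x : TruncTree p,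
        (|(TruncTree.toTree p x).coeff| *
          (treeConst K CE B (A (TruncTree.toTree p x)) (TruncTree.toTree p x) * h ^ (p + 1) +
            e x N)) := by
      rw [truncSum, truncSum, ← Finset.sum_sub_distrib]
      refine norm_sum_le_of_le _ fun x _ => ?_
      rw [← smul_sub, norm_smul, norm_mul, Real.norm_eq_abs, Real.norm_of_nonneg (by positivity),
        mul_assoc]
      exact mul_le_mul_of_nonneg_left (hle x N) (abs_nonneg _)
    have h4 : ∑ x : TruncTree p, (|(TruncTree.toTree p x).coeff| *
          (treeConst K CE B (A (TruncTree.toTree p x)) (TruncTree.toTree p x) * h ^ (p + 1) +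
            e x N)) = (∑ x : TruncTree p, |(TruncTree.toTree p x).coeff| *
          treeConst K CE B (A (TruncTree.toTree p x)) (TruncTree.toTree p x)) * h ^ (p + 1) +
            ∑ x : TruncTree p, |(TruncTree.toTree p x).coeff| * e x N := by
      rw [Finset.sum_mul, ← Finset.sum_add_distrib]
      exact Finset.sum_congr rfl fun x _ => by ring
    rw [h4] at h3
    have e1 : ∀ a b z a' b' : X, a - b = (a - z - a') - (b - z - b') + (a' - b') := by
      intros; abel
    rw [e1 _ _ (S h w) (truncSum (lawsonTab m S h) (stageDeriv m S g h w) h p (lawsonWeight m S h))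
      (truncSum (lawsonTab (eulerMethod N) S h) (stageDeriv (eulerMethod N) S g h w) h p
          (lawsonWeight (eulerMethod N) S h))]
    refine (norm_add_le _ _).trans ((add_le_add ((norm_sub_le _ _).trans (add_le_add h1 h2))
      h3).trans (le_of_eq ?_))
    rw [compareConst]
    ring

end LocalError

/-! ### Passage to the limit and the stiff order bound -/

theorem IsCkLip.mono {V X : Type*} [NormedAddCommGroup V] [NormedSpace ℝ V]
    [NormedAddCommGroup X] [NormedSpace ℝ X] {k : ℕ} {L L' : ℝ} {f : V → X} {D : Set V}
    (hf : IsCkLip k L f D) (hL : L ≤ L') : IsCkLip k L' f D :=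
  ⟨hf.1, fun x hx y hy => (hf.2 x hx y hy).trans
    (mul_le_mul_of_nonneg_right hL (norm_nonneg _))⟩

theorem PolyApprox.mono {ν X : Type*} [Fintype ν] [NormedAddCommGroup X] [NormedSpace ℝ X]
    {n : ℕ} {ε ε' : ℝ} {F : (ν → ℝ) → X} {D : Set (ν → ℝ)} (hF : PolyApprox n ε F D)
    (hε : ε ≤ ε') : PolyApprox n ε' F D :=
  hF.imp fun _ hd x hx => (hd x hx).trans hε

section StiffOrder

variable {X : Type*} [NormedAddCommGroup X] [NormedSpace ℝ X] {S : ℝ → X →L[ℝ] X} {g : X → X}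
  {T : ℝ} {u : ℝ → X} {CE B K r : ℝ} {p s : ℕ} {m : RKMethod s}

theorem BoundedDerivs.norm_sub_le {U : Set X} (hg : BoundedDerivs p g U B) (hU : IsOpen U)
    (hp : 0 < p) {x y : X} (hxy : ∀ t ∈ Icc (0 : ℝ) 1, x + t • (y - x) ∈ U) :
    ‖g y - g x‖ ≤ B * ‖y - x‖ := by
  simpa using norm_sub_taylor_fderiv_le (n := 1) hU (fun k hk => hg.1 k (by omega))
    (hg.2 1 hp) hxy

/-- The linear flow stays within `r / 4` of the solution at the same time, so balls of radius `r /
2` around it remain in the `r`-neighbourhood of the trajectory. -/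
theorem stepBounds_of_small [CompleteSpace X] (hS : IsC0Semigroup S)
    (hCE : ∀ t, 0 ≤ t → ‖S t‖ ≤ CE)
    (hu : IsMildSolution S g T u) (hB : ∀ t ∈ Icc 0 T, ‖g (u t)‖ ≤ B) (hB0 : 0 ≤ B)
    {t h : ℝ} (ht : 0 ≤ t) (hh : 0 < h) (hth : t + h ≤ T) (hr : h * (CE * B) ≤ r / 4)
    (hc : ∀ i, m.c i ∈ Icc (0 : ℝ) 1) (hK : ∀ i, ∑ j, |m.tab i j| ≤ K)
    (hKb : ∑ j, |m.b j| ≤ K) (hstage : ∀ i j, j < i → ‖S ((m.c i - m.c j) * h)‖ ≤ CE) :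
    StepBounds m S h (u t) (Metric.thickening r (u '' Icc 0 T)) CE K (r / 2) where
  sum_tab := hK
  sum_b := hKb
  norm_stage := hstage
  norm_step j := hCE _ (mul_nonneg (sub_nonneg.2 (hc j).2) hh.le)
  mem j z hz := by
    have hCE0 : 0 ≤ CE := (norm_nonneg _).trans (hCE 0 le_rfl)
    have hx0 : 0 ≤ m.c j * h := mul_nonneg (hc j).1 hh.le
    have hxh : m.c j * h ≤ h := mul_le_of_le_one_left hh.le (hc j).2
    have h1 := hu.norm_sub_le hS hCE hB ht hx0 (by linarith)
    have h2 : CE * B * (m.c j * h) ≤ r / 4 :=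
      (mul_le_mul_of_nonneg_left hxh (by positivity)).trans ((mul_comm _ _).trans_le hr)
    refine Metric.mem_thickening_iff.2 ⟨u (t + m.c j * h), ⟨_, ⟨by linarith, by linarith⟩, rfl⟩, ?_⟩
    rw [dist_eq_norm]
    have h3 := norm_sub_le_norm_sub_add_norm_sub z (S (m.c j * h) (u t)) (u (t + m.c j * h))
    rw [norm_sub_rev (S (m.c j * h) (u t))] at h3
    have hr0 : 0 ≤ r / 4 := le_trans (by positivity) hr
    linarith [norm_nonneg (z - S (m.c j * h) (u t))]

/-- The local error of a Lawson method under the polynomial approximability of the integrands. -/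
theorem norm_sub_lawsonStep_le [CompleteSpace X] (hp : m.HasOrder p) (hS : IsC0Semigroup S)
    (hCE : ∀ t, 0 ≤ t → ‖S t‖ ≤ CE) (hu : IsMildSolution S g T u)
    (hg : BoundedDerivs p g (Metric.thickening r (u '' Icc 0 T)) B) (hB0 : 0 ≤ B) (hr0 : 0 < r)
    (hK : 1 ≤ K) (hKa : ∀ i, ∑ j, |m.tab i j| ≤ K) (hKb : ∑ j, |m.b j| ≤ K)
    (hc : ∀ i, m.c i ∈ Icc (0 : ℝ) 1)
    {t h : ℝ} (ht : 0 ≤ t) (hh : 0 < h) (hth : t + h ≤ T)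
    (hsmall : h * (K * CE * B * (p + 1) + 1) ≤ 1 / 2)
    (hsmall' : h * (K * CE * B * (p + 1) + 1) ≤ r / 4)
    (hstage : ∀ i j, j < i → ‖S ((m.c i - m.c j) * h)‖ ≤ CE)
    {A : RTree → ℝ} (hA : ∀ τ, 0 ≤ A τ)
    (happrox : ∀ τ : RTree, τ.order ≤ p → ∃ D : Set (τ.Node → ℝ),
      (∀ φ : τ.Node → Fin s, τ.treeWeight m.tab m.b φ ≠ 0 → (fun v => m.c (φ v)) ∈ D) ∧
      (∀ (N : ℕ) (φ : τ.Node → Fin N),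
        τ.treeWeight (eulerMethod N).tab (eulerMethod N).b φ ≠ 0 →
          (fun v => (eulerMethod N).c (φ v)) ∈ D) ∧
      PolyApprox (p - τ.order) (A τ * h ^ (p - τ.order + 1)) (τ.integrand S g h (u t) 1) D) :
    ‖u (t + h) - m.lawsonStep S g h (u t)‖ ≤
      (CE * B + compareConst p K CE B A) * h ^ (p + 1) := by
  set U := Metric.thickening r (u '' Icc 0 T)
  have hU : IsOpen U := Metric.isOpen_thickening
  have hCE0 : 0 ≤ CE := (norm_nonneg _).trans (hCE 0 le_rfl)
  have hK0 : 0 ≤ K := zero_le_one.trans hK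
  have hgu : ∀ t ∈ Icc 0 T, ‖g (u t)‖ ≤ B := fun t ht =>
    hg.norm_le (Metric.self_subset_thickening hr0 _ ⟨t, ht, rfl⟩)
  set Q := K * CE * B with hQ
  have hQ0 : 0 ≤ Q := by positivity
  have hp0 : (0 : ℝ) ≤ p := Nat.cast_nonneg p
  have hQ1 : h * Q ≤ h * (Q * (p + 1) + 1) := by gcongr; nlinarith
  have hQ2 : h * (K * CE * (B * p)) ≤ 1 := by
    refine le_trans ?_ (hsmall.trans (by norm_num))
    gcongr; rw [hQ]; nlinarith
  have hQ3 : h * (CE * B) ≤ h * Q := by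
    rw [hQ, mul_assoc K]
    exact mul_le_mul_of_nonneg_left (le_mul_of_one_le_left (by positivity) hK) hh.le
  have hh1 : h ≤ 1 := by nlinarith [mul_nonneg hh.le (mul_nonneg hQ0 (by linarith : 0 ≤ (p : ℝ) + 1))]
  have hm : StepBounds m S h (u t) U CE K (r / 2) :=
    stepBounds_of_small hS hCE hu hgu hB0 ht hh hth (by linarith) hc hKa hKb hstage
  have hT : 0 ≤ ∑ x : TruncTree p, |(TruncTree.toTree p x).coeff| *
      treeConst K CE B (A (TruncTree.toTree p x)) (TruncTree.toTree p x) :=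
    Finset.sum_nonneg fun x _ => mul_nonneg (abs_nonneg _)
      (add_nonneg (mul_nonneg (by positivity) (hA _)) (by positivity))
  have hC := truncConst_nonneg (mul_nonneg hK0 hCE0) hB0 p
  -- For `p = 0` no Lipschitz bound on `g` is available, so the Euler limit is bypassed: solution
  -- and method are both within `O(h)` of `S h (u t)`.
  rcases Nat.eq_zero_or_pos p with rfl | hp'
  · have h1 := hu.norm_sub_le hS hCE hgu ht hh.le hth
    have h2 := hm.norm_lawsonStep_sub_truncSum_le hCE0 hK0 hh.le hB0 hU hg (half_pos hr0)
      (by linarith) hQ2 (by linarith)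
    rw [truncSum_zero, sub_zero, norm_sub_rev] at h2
    refine (norm_sub_le_norm_sub_add_norm_sub _ _ _).trans ((add_le_add h1 h2).trans ?_)
    rw [compareConst, zero_add, pow_one, ← add_mul]
    exact mul_le_mul_of_nonneg_right (by linarith) hh.le
  · have hE : ∀ N, StepBounds (eulerMethod N) S h (u t) U CE K (r / 2) := fun N =>
      stepBounds_of_small hS hCE hu hgu hB0 ht hh hth (by linarith) eulerMethod_c_mem
        (fun i => (RTree.sum_abs_eulerRow_le i.2.le).trans hK)
        (by rw [eulerMethod_b]; exact (RTree.sum_abs_eulerRow_le le_rfl).trans hK)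
        fun i j hij => hCE _ (mul_nonneg (sub_nonneg.2
          (RTree.monotone_eulerMethod_c N hij.le)) hh.le)
    obtain ⟨e, he, hle⟩ := exists_norm_lawsonStep_sub_le hp hm hE hCE0 hK hh hh1 hB0 hU hg
      (half_pos hr0) (by linarith) hQ2 (by linarith) hA happrox
    have hlip : ∀ t ∈ Icc 0 T, ∀ y, ‖y - u t‖ < r → ‖g y - g (u t)‖ ≤ B * ‖y - u t‖ := by
      intro t ht y hy
      refine hg.norm_sub_le hU hp' fun a ha => Metric.mem_thickening_iff.2 ⟨u t, ⟨t, ht, rfl⟩, ?_⟩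
      rw [dist_eq_norm, add_sub_cancel_left, norm_smul, Real.norm_of_nonneg ha.1]
      exact (mul_le_of_le_one_left (norm_nonneg _) ha.2).trans_lt hy
    have hlim := hu.tendsto_euler hS hCE hr0 hlip hB0 ht hh hth (by linarith)
    have h1 : Tendsto (fun N => ‖m.lawsonStep S g h (u t) -
        (eulerMethod N).lawsonStep S g h (u t)‖) atTop
        (𝓝 ‖m.lawsonStep S g h (u t) - u (t + h)‖) := (tendsto_const_nhds.sub hlim).norm
    -- The rate at which `e N` vanishes may depend on the problem and on `h`; only the part uniform
    -- in `N` survives the limit.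
    have h2 := le_of_tendsto_of_tendsto' h1 (tendsto_const_nhds.add he) hle
    rw [add_zero, norm_sub_rev] at h2
    refine h2.trans (mul_le_mul_of_nonneg_right ?_ (by positivity))
    linarith [mul_nonneg hCE0 hB0]

end StiffOrder

end Lawson

end

theorem mainTheorem2 {s : ℕ} (m : Lawson.RKMethod s) (p : ℕ)
    (hp : m.HasOrder p) (hc : ∀ i, m.c i ∈ Set.Icc (0 : ℝ) 1)
    (CE B r H M : ℝ) (hr : 0 < r) (hH : 0 < H) :
    ∃ C h₀ : ℝ, 0 < h₀ ∧
      ∀ (X : Type*) [NormedAddCommGroup X] [NormedSpace ℝ X] [CompleteSpace X]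
        (A : X →ₗ.[ℝ] X) (S : ℝ → X →L[ℝ] X) (g : X → X) (T : ℝ) (u : ℝ → X),
        Lawson.IsGenerator (-A) S →
        Lawson.IsMildSolution S g T u →
        Lawson.BoundedDerivs p g (Metric.thickening r (u '' Set.Icc 0 T)) B →
        ((Lawson.IsC0Group S ∧ (∀ t, ‖S t‖ ≤ CE) ∧
            ∀ τ : Lawson.RTree, τ.order ≤ p → ∀ t ∈ Set.Icc 0 T, ∀ h ∈ Set.Ioc 0 H,
              Lawson.IsCkLip (p - τ.order) M (τ.integrand S g h (u t) 1) τ.cube) ∨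
          (Monotone m.c ∧ Lawson.IsC0Semigroup S ∧ (∀ t, 0 ≤ t → ‖S t‖ ≤ CE) ∧
            ∀ τ : Lawson.RTree, τ.order ≤ p → ∀ t ∈ Set.Icc 0 T, ∀ h ∈ Set.Ioc 0 H,
              Lawson.IsCkLip (p - τ.order) (M * h ^ (p - τ.order + 1))
                (τ.integrand S g h (u t) 1) (τ.simplex 1))) →
        ∀ t h : ℝ, 0 ≤ t → 0 < h → h ≤ h₀ → t + h ≤ T →
          ‖u (t + h) - m.lawsonStep S g h (u t)‖ ≤ C * h ^ (p + 1) := by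
  set K : ℝ := 1 + ∑ i, ∑ j, |m.tab i j| + ∑ j, |m.b j|
  have hsa : 0 ≤ ∑ i, ∑ j, |m.tab i j| :=
    Finset.sum_nonneg fun _ _ => Finset.sum_nonneg fun _ _ => abs_nonneg _
  have hsb : 0 ≤ ∑ j, |m.b j| := Finset.sum_nonneg fun _ _ => abs_nonneg _
  have hK : 1 ≤ K := by linarith
  have hKa : ∀ i, ∑ j, |m.tab i j| ≤ K := fun i => by
    have := Finset.single_le_sum (f := fun i => ∑ j, |m.tab i j|)
      (fun _ _ => Finset.sum_nonneg fun _ _ => abs_nonneg _) (Finset.mem_univ i)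
    linarith
  have hKb : ∑ j, |m.b j| ≤ K := by linarith
  -- The single quantity `h * Q` controls every smallness condition. Absolute values appear because
  -- the constants are fixed before any problem, with no sign assumed.
  set Q : ℝ := K * |CE| * |B| * (p + 1) + 1
  have hQ : 0 < Q := by positivity
  -- The first summand serves the semigroup case, the second the group case, where regularity is
  -- used only at step size `H`.
  let E : Lawson.RTree → ℝ := fun τ => |M| + |CE| * (|M| / H ^ (p - τ.order + 1))
  have hE : ∀ τ, 0 ≤ E τ := fun τ => by positivity
  refine ⟨|CE| * |B| + Lawson.compareConst p K |CE| |B| E,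
    min H (min (1 / 2 / Q) (r / 4 / Q)), by positivity, ?_⟩
  intro X _ _ _ A S g T u _ hu hg hcases t h ht hh hh0 hth
  have hhH : h ≤ H := hh0.trans (min_le_left _ _)
  have hs1 : h * Q ≤ 1 / 2 :=
    (le_div_iff₀ hQ).1 (hh0.trans ((min_le_right _ _).trans (min_le_left _ _)))
  have hs2 : h * Q ≤ r / 4 :=
    (le_div_iff₀ hQ).1 (hh0.trans ((min_le_right _ _).trans (min_le_right _ _)))
  have htT : t ∈ Set.Icc 0 T := ⟨ht, by linarith⟩
  have hg' : Lawson.BoundedDerivs p g (Metric.thickening r (u '' Set.Icc 0 T)) |B| :=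
    ⟨hg.1, fun k hk x hx => (hg.2 k hk x hx).trans (le_abs_self B)⟩
  rcases hcases with ⟨hS, hCE, hreg⟩ | ⟨hmono, hS, hCE, hreg⟩
  · have hCE' : ∀ t, ‖S t‖ ≤ |CE| := fun t => (hCE t).trans (le_abs_self CE)
    refine Lawson.norm_sub_lawsonStep_le hp hS.isC0Semigroup (fun t _ => hCE' t) hu hg'
      (abs_nonneg B) hr hK hKa hKb hc ht hh hth hs1 hs2 (fun _ _ _ => hCE' _) hE
      fun τ hτ => ⟨τ.cube, fun φ _ => ⟨fun v => (hc _).1, fun v => (hc _).2⟩,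
        fun N φ _ => ⟨fun v => (Lawson.eulerMethod_c_mem _).1,
          fun v => (Lawson.eulerMethod_c_mem _).2⟩, ?_⟩
    refine (Lawson.RTree.polyApprox_integrand_of_group hS hCE' (abs_nonneg M) hh hhH
      ((hreg τ hτ t htT H ⟨hH, le_rfl⟩).mono (le_abs_self M))).mono ?_
    have e : |CE| * (|M| * (h / H) ^ (p - τ.order + 1)) =
        |CE| * (|M| / H ^ (p - τ.order + 1)) * h ^ (p - τ.order + 1) := by
      rw [div_pow]
      ring
    rw [e]
    exact mul_le_mul_of_nonneg_right (le_add_of_nonneg_left (abs_nonneg M)) (by positivity)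
  · have hCE' : ∀ t, 0 ≤ t → ‖S t‖ ≤ |CE| := fun t ht => (hCE t ht).trans (le_abs_self CE)
    refine Lawson.norm_sub_lawsonStep_le hp hS hCE' hu hg'
      (abs_nonneg B) hr hK hKa hKb hc ht hh hth hs1 hs2
      (fun i j hij => hCE' _ (mul_nonneg (sub_nonneg.2 (hmono hij.le)) hh.le)) hE
      fun τ hτ => ⟨τ.simplex 1, Lawson.RTree.mem_simplex_of_monotone hmono hc τ,
        fun N => Lawson.RTree.mem_simplex_of_monotone (Lawson.RTree.monotone_eulerMethod_c N)
          Lawson.eulerMethod_c_mem τ, ?_⟩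
    have hle : M * h ^ (p - τ.order + 1) ≤ E τ * h ^ (p - τ.order + 1) :=
      mul_le_mul_of_nonneg_right ((le_abs_self M).trans (le_add_of_nonneg_right (by positivity)))
        (by positivity)
    exact Lawson.RTree.polyApprox_integrand_of_simplex (mul_nonneg (hE τ) (by positivity))
      ((hreg τ hτ t htT h ⟨hh, hhH⟩).mono hle)
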